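/- Let $\Theta$ be a subset of a real vector space and let $W(a,\theta)=aW(1,\theta)+(1-a)W(0,\theta)$ be the welfare of action $a\in[0,1]$, with welfare contrast $U(\theta)=W(1,\theta)-W(0,\theta)$. The data are $Y\sim N(m(\theta),\Sigma)$ in $\mathbb{R}^n$ with $\Sigma$ known and positive definite. A decision rule is a measurable $d:\mathbb{R}^n\to[0,1]$; it is randomized unless $d(y)\in\{0,1\}$ for Lebesgue-almost every $y$. Its expected regret is $R(d,\theta)=U(\theta)\,(\mathbf{1}\{U(\theta)\ge 0\}-\mathbb{E}_{m(\theta)}[d(Y)])$, and $d$ is minimax-regret (MMR) optimal if $\sup_{\theta\in\Theta}R(d,\theta)=\inf_{d'}\sup_{\theta\in\Theta}R(d',\theta)$, the infimum being over all decision rules. Let $M=m(\Theta)$, $\overline I(\mu)=\sup\{U(\theta):\theta\in\Theta,\ m(\theta)=\mu\}$ and $\underline I(\mu)=\inf\{U(\theta):\theta\in\Theta,\ m(\theta)=\mu\}$. All suprema and infima are taken in the extended reals. Assume that $\Theta$ is convex, nonempty and centrosymmetric ($\theta\in\Theta$ implies $-\theta\in\Theta$), that $m$ and $U$ are linear, and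 that there is a nonempty open set $\mathcal S\subseteq M$ with $\underline I(\mu)<0<\overline I(\mu)$ for all $\mu\in\mathcal S$. Let $w^*\in\mathbb{R}^n\setminus\{0\}$ be such that there is an MMR optimal rule $d^*$ that depends on the data only through $(w^*)^\top Y$ and satisfies $\mathbb{E}_{m(\theta)}[d^*(Y)]=1/2$ whenever $\theta\in\Theta$, $m(\theta)=0$, and $\sup_{\theta\in\Theta}R(d^*,\theta)=\sup_{\theta\in\Theta,\,m(\theta)=0}R(d^*,\theta)$. Assume that $\overline I(\mu)>\overline I(0)$ for some $\mu\in M$. Write $\sigma=\sqrt{(w^*)^\top\Sigma w^*}$ and $\overline k(\gamma)=\sup\{U(\theta):\theta\in\Theta,\ (w^*)^\top m(\theta)=\gamma\}$, and let $\partial\overline k(0)$ be the set of $s\in\mathbb{R}$ with $\overline k(\gamma)\le\overline k(0)+s\gamma$ for all $\gamma$ in $\{(w^*)^\top m(\theta):\theta\in\Theta\}$. Let $s$ be the element of $\partial\overline k(0)$ of largest absolute value (if $w^*$ is oriented, by replacing it with $-w^*$ if necessary, so that the largest element of $\partial\overline k(0)$ is nonnegative, then $s$ is that largest element). Assume that $\overline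 I(0)$ is large enough, in the sense that $\overline I(0)>\sqrt{\pi/2}\,\sigma\,|s|$. Then: (i) There are infinitely many MMR optimal rules, no two of which are equal Lebesgue-almost everywhere. Moreover, there is a unique $\rho^*\in(0,\overline k(0)/|s|)$ with $\frac{|s|}{2\overline k(0)}\rho^*-\frac12+\Phi(-\rho^*/\sigma)=0$, where $\Phi$ is the standard normal distribution function, and the piecewise linear rule $d^*_{\mathrm{linear}}(\operatorname{sign}(s)\,(w^*)^\top Y)$ is MMR optimal, where $d^*_{\mathrm{linear}}(t)$ equals $0$ for $t<-\rho^*$, $(t+\rho^*)/(2\rho^*)$ for $-\rho^*\le t\le\rho^*$, and $1$ for $t>\rho^*$. (ii) Every MMR optimal rule that depends on the data only through $(w^*)^\top Y$, and is weakly increasing in this argument, is randomized. (iii) If $\overline I$ is differentiable at $0$, then no linear threshold rule $\mathbf{1}\{w^\top Y\ge c\}$, with $w\in\mathbb{R}^n$ and $c\in\mathbb{R}\cup\{-\infty,\infty\}$, is MMR optimal. -/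

import Mathlib

open MeasureTheory ProbabilityTheory

noncomputable section

/-- A treatment choice problem: a parameter set `Θ` inside a real vector space `V` (possibly of
infinite dimension), the payoffs `W1 = W(1, ·)` and `W0 = W(0, ·)` of the two pure actions, the mean
function `m`, and the positive definite covariance matrix `S` of the Gaussian data
`Y ∼ N(m(θ), S)` in `ℝⁿ`. -/
structure TreatmentProblem (V : Type*) [AddCommGroup V] [Module ℝ V] (n : ℕ) where
  Θ : Set V
  W1 : V → ℝ
  W0 : V → ℝ
  m : V → EuclideanSpace ℝ (Fin n)
  S : Matrix (Fin n) (Fin n) ℝ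
  posDef : S.PosDef

/-- Decision rules: measurable maps from the data to `[0, 1]`. -/
def decisionRules (n : ℕ) : Set (EuclideanSpace ℝ (Fin n) → ℝ) :=
  {d | Measurable d ∧ ∀ y, d y ∈ Set.Icc (0 : ℝ) 1}

/-- A rule is randomized unless it takes values in `{0, 1}` at Lebesgue-almost every data point. -/
def IsRandomized {n : ℕ} (d : EuclideanSpace ℝ (Fin n) → ℝ) : Prop :=
  ¬ ∀ᵐ y ∂(volume : Measure (EuclideanSpace ℝ (Fin n))), d y = 0 ∨ d y = 1

/-- The rule depends on the data only through the index `wᵀy`. -/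
def DependsThrough {n : ℕ} (w : EuclideanSpace ℝ (Fin n))
    (d : EuclideanSpace ℝ (Fin n) → ℝ) : Prop :=
  ∃ f : ℝ → ℝ, Measurable f ∧ (∀ t, f t ∈ Set.Icc (0 : ℝ) 1) ∧ ∀ y, d y = f (inner ℝ w y)

/-- The rule depends on the data only through `wᵀy` and is weakly increasing in this argument. -/
def IncreasingThrough {n : ℕ} (w : EuclideanSpace ℝ (Fin n))
    (d : EuclideanSpace ℝ (Fin n) → ℝ) : Prop :=
  ∃ f : ℝ → ℝ, Monotone f ∧ (∀ t, f t ∈ Set.Icc (0 : ℝ) 1) ∧ ∀ y, d y = f (inner ℝ w y)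

open Classical in
/-- The linear threshold rule `1{wᵀy ≥ c}`, with `c` in the extended reals. -/
def thresholdRule {n : ℕ} (w : EuclideanSpace ℝ (Fin n)) (c : EReal) :
    EuclideanSpace ℝ (Fin n) → ℝ :=
  fun y => if c ≤ ((inner ℝ w y : ℝ) : EReal) then 1 else 0

/-- The piecewise linear map: `0` below `-ρ`, `(t + ρ) / (2ρ)` on `[-ρ, ρ]`, `1` above `ρ`. -/
def piecewiseLinear (ρ t : ℝ) : ℝ :=
  if t < -ρ then 0 else if t ≤ ρ then (t + ρ) / (2 * ρ) else 1

/-- The standard normal cumulative distribution function. -/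
def stdNormalCDF (x : ℝ) : ℝ := cdf (gaussianReal 0 1) x

namespace TreatmentProblem

variable {V : Type*} [AddCommGroup V] [Module ℝ V] {n : ℕ} (P : TreatmentProblem V n)

/-- Welfare of the action `a ∈ [0, 1]`. -/
def welfare (a : ℝ) (θ : V) : ℝ := a * P.W1 θ + (1 - a) * P.W0 θ

/-- The welfare contrast. -/
def U (θ : V) : ℝ := P.welfare 1 θ - P.welfare 0 θ

/-- Expectation of `d(Y)` for `Y ∼ N(μ, S)`. -/
def expect (μ : EuclideanSpace ℝ (Fin n)) (d : EuclideanSpace ℝ (Fin n) → ℝ) : ℝ :=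
  ∫ y, d y ∂(multivariateGaussian μ P.S)

open Classical in
/-- Expected regret of the rule `d` in the state `θ`. -/
def regret (d : EuclideanSpace ℝ (Fin n) → ℝ) (θ : V) : ℝ :=
  P.U θ * ((if 0 ≤ P.U θ then 1 else 0) - P.expect (P.m θ) d)

/-- Worst-case expected regret over `Θ`, in the extended reals. -/
def worstRegret (d : EuclideanSpace ℝ (Fin n) → ℝ) : EReal :=
  ⨆ θ ∈ P.Θ, (P.regret d θ : EReal)

/-- Minimax regret optimality. -/
def IsMMR (d : EuclideanSpace ℝ (Fin n) → ℝ) : Prop :=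
  d ∈ decisionRules n ∧ P.worstRegret d = ⨅ d' ∈ decisionRules n, P.worstRegret d'

/-- The set of reduced-form parameters. -/
def M : Set (EuclideanSpace ℝ (Fin n)) := P.m '' P.Θ

/-- The identified set for the welfare contrast, given `μ`. -/
def idSet (μ : EuclideanSpace ℝ (Fin n)) : Set ℝ := {u | ∃ θ ∈ P.Θ, P.m θ = μ ∧ P.U θ = u}

/-- Upper bound of the identified set, in the extended reals. -/
def upperI (μ : EuclideanSpace ℝ (Fin n)) : EReal := ⨆ u ∈ P.idSet μ, (u : EReal)

/-- Lower bound of the identified set, in the extended reals. -/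
def lowerI (μ : EuclideanSpace ℝ (Fin n)) : EReal := ⨅ u ∈ P.idSet μ, (u : EReal)

/-- Nontrivial partial identification: on a nonempty open set of reduced-form parameters, the
identified set contains both positive and negative values. -/
def NontrivialPartialId : Prop :=
  ∃ O : Set (EuclideanSpace ℝ (Fin n)), IsOpen O ∧ O.Nonempty ∧ O ⊆ P.M ∧
    ∀ μ ∈ O, P.lowerI μ < 0 ∧ 0 < P.upperI μ

/-- `Θ` is convex, centrosymmetric and nonempty, and `m` and `U` are linear on `Θ` (they agree on
`Θ` with linear maps). -/
structure IsLinearSymmetric : Prop where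
  convex : Convex ℝ P.Θ
  neg_mem : ∀ θ ∈ P.Θ, -θ ∈ P.Θ
  nonempty : P.Θ.Nonempty
  linear_m : ∃ L : V →ₗ[ℝ] EuclideanSpace ℝ (Fin n), ∀ θ ∈ P.Θ, P.m θ = L θ
  linear_U : ∃ L : V →ₗ[ℝ] ℝ, ∀ θ ∈ P.Θ, P.U θ = L θ

/-- The standard deviation of `wᵀY`. -/
def sd (w : EuclideanSpace ℝ (Fin n)) : ℝ := √(w.ofLp ⬝ᵥ P.S.mulVec w.ofLp)

/-- The values of `wᵀm(θ)`, for `θ ∈ Θ`. -/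
def Gam (w : EuclideanSpace ℝ (Fin n)) : Set ℝ := {γ | ∃ θ ∈ P.Θ, inner ℝ w (P.m θ) = γ}

/-- The largest welfare contrast compatible with `wᵀm(θ) = γ`, in the extended reals. -/
def kbar (w : EuclideanSpace ℝ (Fin n)) (γ : ℝ) : EReal :=
  ⨆ θ ∈ {θ ∈ P.Θ | inner ℝ w (P.m θ) = γ}, (P.U θ : EReal)

/-- The superdifferential of `kbar w` at `0`. -/
def superdiff (w : EuclideanSpace ℝ (Fin n)) : Set ℝ :=
  {s | ∀ γ ∈ P.Gam w, P.kbar w γ ≤ P.kbar w 0 + ((s * γ : ℝ) : EReal)}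

/-- The conditions that determine the half-width `ρ` of the piecewise linear rule with index `w`,
for the slope `s > 0`: `0 < ρ < k/s` and `(s/(2k)) ρ - 1/2 + Φ(-ρ/σ) = 0`, where `k` is the largest
welfare contrast compatible with `wᵀm(θ) = 0` and `σ` is the standard deviation of `wᵀY`. -/
def IsHalfWidth (w : EuclideanSpace ℝ (Fin n)) (s ρ : ℝ) : Prop :=
  ρ ∈ Set.Ioo 0 ((P.kbar w 0).toReal / s) ∧
    s / (2 * (P.kbar w 0).toReal) * ρ - 1 / 2 + stdNormalCDF (-ρ / P.sd w) = 0

end TreatmentProblem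

end

/-!
The data are uninformative about `θ` versus `-θ` when `m(θ) = 0`, so that every rule has worst-case
regret at least `k / 2`, where `k` is the largest welfare contrast compatible with mean zero. The
given index rule attains this bound. Hence a rule is minimax-regret optimal if and only if its
regret is at most `k / 2` everywhere, and the optimal rules form a convex set
(`IsLinearSymmetric.exists_hasTangent`, `HasTangent.isMMR_convexCombo`).

The welfare contrast is at most `k + s γ` where `γ = wᵀm(θ)`. An index rule with mean `G(γ)` is
therefore optimal if `(k + s γ) (1 - G(γ)) ≤ k / 2`, with equality at `γ = 0`. If `G` is a symmetric
distribution function with a log-concave density, this holds as soon as the derivative of the left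
side vanishes at `0` (`one_add_mul_one_sub_le_half`). For the piecewise linear rule, `G` is a normal
distribution function smoothed by a uniform one, log-concave because the mean of a truncated normal
variable increases with the truncation points, and the derivative vanishes by the half-width
equation. A normal distribution function of the index, suitably scaled, is a second optimal rule,
and mixtures of the two give infinitely many.

A rule with values in `{0, 1}` that jumps where `vᵀy = c` has mean `Φ((vᵀμ - c) / P.sd v)`, and
optimality forces `c = 0`. Its regret bound then forces slopes that are too steep: for `v = w`, the
number `√(2 / π) k / P.sd w` is a supergradient of `kbar w` at `0`, and if the upper bound of the
identified set is differentiable at `0`, its gradient `s w` there equals `(√(2 / π) k / P.sd v) v`.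
Either contradicts `k > √(π / 2) (P.sd w) |s|`, the former because `|s|` is maximal, the latter on
applying `P.sd` to both sides.
-/

open Filter Topology

noncomputable section

/-! ### A tail bound for log-concave distributions -/

/-- Let `G` be a distribution function with median `0` and with a positive density `g` whose score
`h = -g'/g` is increasing (that is, `g` is log-concave) and vanishes at `0`. Then the product of
the survival function `1 - G` with the line `1 + 2 g(0) x` is largest at `0`. Indeed `1 - G` is
log-concave, so that it stays below its log-linear tangent `exp (-2 g(0) x) / 2`, which in turn
stays below `1 / (2 (1 + 2 g(0) x))` where the line is positive. -/
theorem one_add_mul_one_sub_le_half {G g h : ℝ → ℝ} (hG : ∀ x, HasDerivAt G (g x) x)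
    (hg : ∀ x, HasDerivAt g (-(h x * g x)) x) (gpos : ∀ x, 0 < g x) (hmono : Monotone h)
    (h0 : h 0 = 0) (hG0 : G 0 = 1 / 2) (hGtop : Tendsto G atTop (𝓝 1))
    (hgtop : Tendsto g atTop (𝓝 0)) (x : ℝ) : (1 + 2 * g 0 * x) * (1 - G x) ≤ 1 / 2 := by
  set τ : ℝ := 2 * g 0 with hτ
  -- `Q = g - τ (1 - G)` decides the sign of the derivative of `(1 - G) exp (τ x)`
  have hτpos : 0 < τ := by have := gpos 0; positivity
  set Q : ℝ → ℝ := fun x => g x - τ * (1 - G x) with hQ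
  have hQd : ∀ x, HasDerivAt Q (g x * (τ - h x)) x := fun x => by
    have := (hg x).sub (((hG x).const_sub 1).const_mul τ)
    exact this.congr_deriv (by ring)
  have hQ0 : Q 0 = 0 := by simp only [hQ, hG0, hτ]; ring
  have hQc : Continuous Q := continuous_iff_continuousAt.2 fun x => (hQd x).continuousAt
  have hQtop : Tendsto Q atTop (𝓝 0) := by
    have := hgtop.sub ((hGtop.const_sub 1).const_mul τ)
    simpa [hQ] using this
  have hQpos : ∀ x, 0 ≤ x → 0 ≤ Q x := by
    intro x hx
    -- `Q' = g (τ - h)` changes sign at most once, from plus to minus, and `Q` vanishes at both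
    -- ends of `[0, ∞)`
    rcases le_total (h x) τ with hle | hle
    · have hm : MonotoneOn Q (Set.Icc 0 x) := by
        refine monotoneOn_of_deriv_nonneg (convex_Icc _ _) hQc.continuousOn
          (fun y _ => (hQd y).differentiableAt.differentiableWithinAt) fun y hy => ?_
        rw [interior_Icc] at hy
        rw [(hQd y).deriv]
        exact mul_nonneg (gpos y).le (sub_nonneg.2 ((hmono hy.2.le).trans hle))
      exact hQ0 ▸ hm (Set.left_mem_Icc.2 hx) (Set.right_mem_Icc.2 hx) hx
    · have hm : AntitoneOn Q (Set.Ici x) := by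
        refine antitoneOn_of_deriv_nonpos (convex_Ici _) hQc.continuousOn
          (fun y _ => (hQd y).differentiableAt.differentiableWithinAt) fun y hy => ?_
        rw [interior_Ici] at hy
        rw [(hQd y).deriv]
        exact mul_nonpos_of_nonneg_of_nonpos (gpos y).le
          (sub_nonpos.2 (hle.trans (hmono (le_of_lt hy))))
      refine le_of_tendsto hQtop ?_
      filter_upwards [eventually_ge_atTop x] with y hy
      exact hm Set.self_mem_Ici hy hy
  have hQneg : ∀ x, x ≤ 0 → Q x ≤ 0 := by
    intro x hx
    have hm : MonotoneOn Q (Set.Iic 0) := by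
      refine monotoneOn_of_deriv_nonneg (convex_Iic _) hQc.continuousOn
        (fun y _ => (hQd y).differentiableAt.differentiableWithinAt) fun y hy => ?_
      rw [interior_Iic] at hy
      rw [(hQd y).deriv]
      have := hmono (le_of_lt hy)
      exact mul_nonneg (gpos y).le (by linarith)
    exact hQ0 ▸ hm hx (Set.self_mem_Iic) hx
  set L : ℝ → ℝ := fun x => (1 - G x) * Real.exp (τ * x) with hL
  have hLd : ∀ x, HasDerivAt L (-(Q x) * Real.exp (τ * x)) x := fun x => by
    have h1 : HasDerivAt (fun x => Real.exp (τ * x)) (Real.exp (τ * x) * (τ * 1)) x :=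
      ((hasDerivAt_id x).const_mul τ).exp
    exact (((hG x).const_sub 1).mul h1).congr_deriv (by simp only [hQ]; ring)
  have hLc : Continuous L := continuous_iff_continuousAt.2 fun x => (hLd x).continuousAt
  have hLle : L x ≤ L 0 := by
    rcases le_total 0 x with hx | hx
    · have hm : AntitoneOn L (Set.Ici 0) := by
        refine antitoneOn_of_deriv_nonpos (convex_Ici _) hLc.continuousOn
          (fun y _ => (hLd y).differentiableAt.differentiableWithinAt) fun y hy => ?_
        rw [interior_Ici] at hy
        rw [(hLd y).deriv]
        exact mul_nonpos_of_nonpos_of_nonneg (neg_nonpos.2 (hQpos y (le_of_lt hy)))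
          (Real.exp_pos _).le
      exact hm Set.self_mem_Ici hx hx
    · have hm : MonotoneOn L (Set.Iic 0) := by
        refine monotoneOn_of_deriv_nonneg (convex_Iic _) hLc.continuousOn
          (fun y _ => (hLd y).differentiableAt.differentiableWithinAt) fun y hy => ?_
        rw [interior_Iic] at hy
        rw [(hLd y).deriv]
        exact mul_nonneg (neg_nonneg.2 (hQneg y (le_of_lt hy))) (Real.exp_pos _).le
      exact hm hx Set.self_mem_Iic hx
  have hG1 : G x ≤ 1 := by
    have hm : Monotone G := monotone_of_deriv_nonneg (fun y => (hG y).differentiableAt)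
      fun y => by rw [(hG y).deriv]; exact (gpos y).le
    exact hm.ge_of_tendsto hGtop x
  have hL0 : L 0 = 1 / 2 := by simp only [hL, hG0, mul_zero, Real.exp_zero]; norm_num
  calc (1 + τ * x) * (1 - G x) ≤ Real.exp (τ * x) * (1 - G x) := by
        have := Real.add_one_le_exp (τ * x)
        exact mul_le_mul_of_nonneg_right (by linarith) (by linarith)
    _ = L x := by simp only [hL]; ring
    _ ≤ 1 / 2 := hL0 ▸ hLle

/-! ### The standard normal distribution -/

theorem gaussianPDFReal_zero_one_apply (x : ℝ) :
    gaussianPDFReal 0 1 x = (√(2 * Real.pi))⁻¹ * Real.exp (-x ^ 2 / 2) := by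
  simp [gaussianPDFReal]

theorem hasDerivAt_stdNormalPDF (x : ℝ) :
    HasDerivAt (gaussianPDFReal 0 1) (-(x * gaussianPDFReal 0 1 x)) x := by
  have h1 : gaussianPDFReal 0 1 = fun x => (√(2 * Real.pi))⁻¹ * Real.exp (-x ^ 2 / 2) :=
    funext gaussianPDFReal_zero_one_apply
  have h2 : HasDerivAt (fun x : ℝ => -x ^ 2 / 2) (-x) x :=
    (((hasDerivAt_pow 2 x).neg).div_const 2).congr_deriv (by simp; ring)
  rw [h1]
  exact (h2.exp.const_mul _).congr_deriv (by ring)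

theorem continuous_stdNormalPDF : Continuous (gaussianPDFReal 0 1) :=
  continuous_iff_continuousAt.2 fun x => (hasDerivAt_stdNormalPDF x).continuousAt

theorem stdNormalPDF_pos (x : ℝ) : 0 < gaussianPDFReal 0 1 x :=
  gaussianPDFReal_pos 0 1 x one_ne_zero

theorem stdNormalPDF_neg (x : ℝ) : gaussianPDFReal 0 1 (-x) = gaussianPDFReal 0 1 x := by
  simp [gaussianPDFReal_zero_one_apply]

theorem tendsto_stdNormalPDF_atTop : Tendsto (gaussianPDFReal 0 1) atTop (𝓝 0) := by
  have h : Tendsto (fun x : ℝ => Real.exp (-x ^ 2 / 2)) atTop (𝓝 0) := by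
    refine Real.tendsto_exp_atBot.comp ?_
    have : Tendsto (fun x : ℝ => x ^ 2 / 2) atTop atTop :=
      (tendsto_pow_atTop two_ne_zero).atTop_div_const (by norm_num)
    exact (tendsto_neg_atTop_atBot.comp this).congr fun x => by simp; ring
  have := h.const_mul (√(2 * Real.pi))⁻¹
  rw [mul_zero] at this
  exact this.congr fun x => (gaussianPDFReal_zero_one_apply x).symm

theorem stdNormalCDF_eq_real (x : ℝ) : stdNormalCDF x = (gaussianReal 0 1).real (Set.Iic x) :=
  cdf_eq_real _ _

theorem stdNormalCDF_eq_integral (x : ℝ) :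
    stdNormalCDF x = ∫ t in Set.Iic x, gaussianPDFReal 0 1 t := by
  rw [stdNormalCDF_eq_real, measureReal_def, gaussianReal_apply_eq_integral _ one_ne_zero,
    ENNReal.toReal_ofReal]
  exact integral_nonneg fun t => gaussianPDFReal_nonneg _ _ _

theorem hasDerivAt_stdNormalCDF (x : ℝ) :
    HasDerivAt stdNormalCDF (gaussianPDFReal 0 1 x) x := by
  have hi := integrable_gaussianPDFReal 0 1
  have h1 : stdNormalCDF = fun x => stdNormalCDF 0 + ∫ t in (0 : ℝ)..x, gaussianPDFReal 0 1 t := by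
    funext x
    rw [stdNormalCDF_eq_integral, stdNormalCDF_eq_integral,
      intervalIntegral.integral_Iic_sub_Iic hi.integrableOn hi.integrableOn |>.symm]
    ring
  rw [h1]
  exact (intervalIntegral.integral_hasDerivAt_right hi.intervalIntegrable
    (continuous_stdNormalPDF.stronglyMeasurableAtFilter _ _)
    continuous_stdNormalPDF.continuousAt).const_add _

theorem continuous_stdNormalCDF : Continuous stdNormalCDF :=
  continuous_iff_continuousAt.2 fun x => (hasDerivAt_stdNormalCDF x).continuousAt

theorem strictMono_stdNormalCDF : StrictMono stdNormalCDF :=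
  strictMono_of_deriv_pos fun x => by
    rw [(hasDerivAt_stdNormalCDF x).deriv]; exact stdNormalPDF_pos x

theorem tendsto_stdNormalCDF_atTop : Tendsto stdNormalCDF atTop (𝓝 1) := tendsto_cdf_atTop _

theorem stdNormalCDF_mem_Icc (x : ℝ) : stdNormalCDF x ∈ Set.Icc (0 : ℝ) 1 :=
  ⟨cdf_nonneg _ x, cdf_le_one _ x⟩

theorem stdNormalCDF_lt_one (x : ℝ) : stdNormalCDF x < 1 :=
  (strictMono_stdNormalCDF (lt_add_one x)).trans_le (stdNormalCDF_mem_Icc _).2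

theorem stdNormalCDF_pos (x : ℝ) : 0 < stdNormalCDF x :=
  (stdNormalCDF_mem_Icc _).1.trans_lt (strictMono_stdNormalCDF (sub_one_lt x))

theorem gaussianReal_real_Ici (x : ℝ) :
    (gaussianReal 0 1).real (Set.Ici x) = stdNormalCDF (-x) := by
  have h := gaussianReal_map_neg (μ := 0) (v := 1)
  rw [neg_zero] at h
  rw [stdNormalCDF_eq_real]
  conv_rhs => rw [← h]
  rw [map_measureReal_apply measurable_neg measurableSet_Iic]
  congr 1
  ext y
  simp

theorem gaussianReal_real_Ioi (x : ℝ) :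
    (gaussianReal 0 1).real (Set.Ioi x) = stdNormalCDF (-x) := by
  have := nullSingletonClass_gaussianReal (μ := 0) (v := 1) one_ne_zero
  rw [← gaussianReal_real_Ici]
  exact measureReal_congr Ioi_ae_eq_Ici

theorem stdNormalCDF_neg (x : ℝ) : stdNormalCDF (-x) = 1 - stdNormalCDF x := by
  rw [← gaussianReal_real_Ioi, stdNormalCDF_eq_real, ← probReal_compl_eq_one_sub measurableSet_Iic,
    Set.compl_Iic]

theorem stdNormalCDF_zero : stdNormalCDF 0 = 1 / 2 := by
  have := stdNormalCDF_neg 0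
  rw [neg_zero] at this
  linarith

theorem sqrt_pi_div_two_mul_stdNormalPDF_zero :
    √(Real.pi / 2) * (2 * gaussianPDFReal 0 1 0) = 1 := by
  rw [gaussianPDFReal_zero_one_apply]
  have h : √(2 * Real.pi) = 2 * √(Real.pi / 2) := by
    rw [show 2 * Real.pi = 2 ^ 2 * (Real.pi / 2) by ring, Real.sqrt_mul (by norm_num),
      Real.sqrt_sq (by norm_num)]
  have : 0 < √(Real.pi / 2) := Real.sqrt_pos.2 (by positivity)
  rw [h]
  norm_num
  field_simp

/-! ### The normal distribution smoothed by a uniform one -/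

/-- The mean of the positive part of `x + Z`, for a standard normal `Z`; it is the antiderivative of
the normal distribution function that vanishes at `-∞`. -/
def normalPosPart (x : ℝ) : ℝ := x * stdNormalCDF x + gaussianPDFReal 0 1 x

theorem hasDerivAt_normalPosPart (x : ℝ) : HasDerivAt normalPosPart (stdNormalCDF x) x :=
  (((hasDerivAt_id x).mul (hasDerivAt_stdNormalCDF x)).add (hasDerivAt_stdNormalPDF x)).congr_deriv
    (by simp)

theorem normalPosPart_neg (x : ℝ) : normalPosPart (-x) = normalPosPart x - x := by
  simp only [normalPosPart, stdNormalCDF_neg, stdNormalPDF_neg]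
  ring

theorem integrable_add_id_gaussianReal (x : ℝ) :
    Integrable (fun z : ℝ => x + z) (gaussianReal 0 1) :=
  (integrable_const x).add ((memLp_id_gaussianReal 1).integrable le_rfl)

theorem integrable_posPart_gaussianReal (x : ℝ) :
    Integrable (fun z : ℝ => max (x + z) 0) (gaussianReal 0 1) :=
  (integrable_add_id_gaussianReal x).pos_part

theorem integral_posPart_gaussianReal (x : ℝ) :
    ∫ z, max (x + z) 0 ∂(gaussianReal 0 1) = normalPosPart x := by
  rw [integral_gaussianReal_eq_integral_smul one_ne_zero]
  have h1 : (fun z => gaussianPDFReal 0 1 z • max (x + z) 0) =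
      (Set.Ioi (-x)).indicator fun z => (x + z) * gaussianPDFReal 0 1 z := by
    funext z
    by_cases hz : z ∈ Set.Ioi (-x)
    · have : -x < z := hz
      rw [Set.indicator_of_mem hz, max_eq_left (by linarith), smul_eq_mul, mul_comm]
    · have : z ≤ -x := not_lt.1 hz
      rw [Set.indicator_of_notMem hz, max_eq_right (by linarith), smul_zero]
  have hd : ∀ z, HasDerivAt (fun z => x * stdNormalCDF z - gaussianPDFReal 0 1 z)
      ((x + z) * gaussianPDFReal 0 1 z) z := fun z =>
    (((hasDerivAt_stdNormalCDF z).const_mul x).sub (hasDerivAt_stdNormalPDF z)).congr_deriv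
      (by ring)
  have hlim : Tendsto (fun z => x * stdNormalCDF z - gaussianPDFReal 0 1 z) atTop (𝓝 (x * 1 - 0)) :=
    (tendsto_stdNormalCDF_atTop.const_mul x).sub tendsto_stdNormalPDF_atTop
  rw [h1, integral_indicator measurableSet_Ioi,
    integral_Ioi_of_hasDerivAt_of_nonneg (hd _).continuousAt.continuousWithinAt
      (fun z _ => hd z) (fun z hz => ?_) hlim]
  · simp only [normalPosPart, stdNormalCDF_neg, stdNormalPDF_neg]
    ring
  · have : -x < z := hz
    exact mul_nonneg (by linarith) (stdNormalPDF_pos z).le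

/-- The mean value theorem for `normalPosPart`, whose derivative, the normal distribution function,
is increasing. -/
theorem normalPosPart_sub_mem_Icc {a b : ℝ} (hab : a ≤ b) :
    normalPosPart b - normalPosPart a ∈
      Set.Icc (stdNormalCDF a * (b - a)) (stdNormalCDF b * (b - a)) := by
  rcases hab.eq_or_lt with rfl | hlt
  · simp
  obtain ⟨c, hc, hceq⟩ := exists_hasDerivAt_eq_slope normalPosPart stdNormalCDF hlt
    (fun x _ => (hasDerivAt_normalPosPart x).continuousAt.continuousWithinAt)
    fun x _ => hasDerivAt_normalPosPart x
  have hpos : 0 < b - a := sub_pos.2 hlt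
  rw [eq_div_iff hpos.ne'] at hceq
  rw [← hceq]
  exact ⟨mul_le_mul_of_nonneg_right (strictMono_stdNormalCDF.monotone hc.1.le) hpos.le,
    mul_le_mul_of_nonneg_right (strictMono_stdNormalCDF.monotone hc.2.le) hpos.le⟩

/-- The distribution function of the sum of a standard normal and an independent uniform variable on
`[-r, r]`, for `r > 0`. -/
def smoothedCDF (r x : ℝ) : ℝ := (normalPosPart (x + r) - normalPosPart (x - r)) / (2 * r)

/-- The density of `smoothedCDF r`. -/
def smoothedPDF (r x : ℝ) : ℝ := (stdNormalCDF (x + r) - stdNormalCDF (x - r)) / (2 * r)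

/-- The score `-g'/g` of the density `g = smoothedPDF r`. -/
def smoothedScore (r x : ℝ) : ℝ :=
  (gaussianPDFReal 0 1 (x - r) - gaussianPDFReal 0 1 (x + r)) /
    (stdNormalCDF (x + r) - stdNormalCDF (x - r))

theorem stdNormalCDF_add_sub_pos {r : ℝ} (hr : 0 < r) (x : ℝ) :
    0 < stdNormalCDF (x + r) - stdNormalCDF (x - r) :=
  sub_pos.2 (strictMono_stdNormalCDF (by linarith))

/-- The density `smoothedPDF r` is log-concave. Its score at `x` is the mean of a standard normal
variable truncated to `[x - r, x + r]`; it lies in that interval, so that it increases with either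
endpoint. -/
theorem monotone_smoothedScore {r : ℝ} (hr : 0 < r) : Monotone (smoothedScore r) := by
  have hd : ∀ x, HasDerivAt (smoothedScore r) _ x := fun x =>
    ((((hasDerivAt_stdNormalPDF (x - r)).comp_sub_const x r).sub
      ((hasDerivAt_stdNormalPDF (x + r)).comp_add_const x r)).div
      (((hasDerivAt_stdNormalCDF (x + r)).comp_add_const x r).sub
      ((hasDerivAt_stdNormalCDF (x - r)).comp_sub_const x r))
      (stdNormalCDF_add_sub_pos hr x).ne')
  refine monotone_of_deriv_nonneg (fun x => (hd x).differentiableAt) fun x => ?_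
  rw [(hd x).deriv]
  refine div_nonneg ?_ (sq_nonneg _)
  have h := normalPosPart_sub_mem_Icc (a := x - r) (b := x + r) (by linarith)
  have h1 : 0 ≤ (x + r) * (stdNormalCDF (x + r) - stdNormalCDF (x - r)) -
      (gaussianPDFReal 0 1 (x - r) - gaussianPDFReal 0 1 (x + r)) := by
    have := h.1
    simp only [normalPosPart] at this
    linarith
  have h2 : 0 ≤ (gaussianPDFReal 0 1 (x - r) - gaussianPDFReal 0 1 (x + r)) -
      (x - r) * (stdNormalCDF (x + r) - stdNormalCDF (x - r)) := by
    have := h.2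
    simp only [normalPosPart] at this
    linarith
  have := add_nonneg (mul_nonneg (stdNormalPDF_pos (x + r)).le h1)
    (mul_nonneg (stdNormalPDF_pos (x - r)).le h2)
  simp only [Pi.sub_apply]
  linarith

theorem smoothedCDF_neg {r : ℝ} (hr : 0 < r) (x : ℝ) :
    smoothedCDF r (-x) = 1 - smoothedCDF r x := by
  have h1 : normalPosPart (-x + r) = normalPosPart (x - r) - (x - r) := by
    rw [← normalPosPart_neg, neg_sub, neg_add_eq_sub]
  have h2 : normalPosPart (-x - r) = normalPosPart (x + r) - (x + r) := by
    rw [← normalPosPart_neg, neg_add']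
  simp only [smoothedCDF, h1, h2]
  field_simp
  ring

theorem one_add_mul_one_sub_smoothedCDF_le {r : ℝ} (hr : 0 < r) (x : ℝ) :
    (1 + 2 * smoothedPDF r 0 * x) * (1 - smoothedCDF r x) ≤ 1 / 2 := by
  refine one_add_mul_one_sub_le_half (g := smoothedPDF r) (h := smoothedScore r) (fun x => ?_)
    (fun x => ?_) (fun x => div_pos (stdNormalCDF_add_sub_pos hr x) (by positivity))
    (monotone_smoothedScore hr) ?_ ?_ ?_ ?_ x
  · exact (((hasDerivAt_normalPosPart (x + r)).comp_add_const x r).sub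
      ((hasDerivAt_normalPosPart (x - r)).comp_sub_const x r)).div_const _
  · refine ((((hasDerivAt_stdNormalCDF (x + r)).comp_add_const x r).sub
      ((hasDerivAt_stdNormalCDF (x - r)).comp_sub_const x r)).div_const _).congr_deriv ?_
    have := (stdNormalCDF_add_sub_pos hr x).ne'
    simp only [smoothedScore, smoothedPDF]
    field_simp
    ring
  · simp [smoothedScore, stdNormalPDF_neg]
  · have := smoothedCDF_neg hr 0
    rw [neg_zero] at this
    linarith
  · have h1 : Tendsto (fun x => stdNormalCDF (x - r)) atTop (𝓝 1) :=
      tendsto_stdNormalCDF_atTop.comp (tendsto_atTop_add_const_right _ (-r) tendsto_id)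
    have h := fun x : ℝ => normalPosPart_sub_mem_Icc (a := x - r) (b := x + r) (by linarith)
    refine tendsto_of_tendsto_of_tendsto_of_le_of_le h1 tendsto_const_nhds (fun x => ?_) fun x => ?_
    · have := (h x).1
      rw [smoothedCDF, le_div_iff₀ (by positivity)]
      linarith
    · have := (h x).2
      have h3 := (stdNormalCDF_mem_Icc (x + r)).2
      rw [smoothedCDF, div_le_one (by positivity)]
      nlinarith
  · have h1 : Tendsto (fun x => stdNormalCDF (x - r)) atTop (𝓝 1) :=
      tendsto_stdNormalCDF_atTop.comp (tendsto_atTop_add_const_right _ (-r) tendsto_id)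
    have h2 : Tendsto (fun x => stdNormalCDF (x + r)) atTop (𝓝 1) :=
      tendsto_stdNormalCDF_atTop.comp (tendsto_atTop_add_const_right _ r tendsto_id)
    have := (h2.sub h1).div_const (2 * r)
    rw [sub_self, zero_div] at this
    exact this

theorem one_add_mul_one_sub_stdNormalCDF_le (x : ℝ) :
    (1 + 2 * gaussianPDFReal 0 1 0 * x) * (1 - stdNormalCDF x) ≤ 1 / 2 :=
  one_add_mul_one_sub_le_half (h := id) hasDerivAt_stdNormalCDF hasDerivAt_stdNormalPDF
    stdNormalPDF_pos monotone_id rfl stdNormalCDF_zero tendsto_stdNormalCDF_atTop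
    tendsto_stdNormalPDF_atTop x

/-! ### Expectations of index rules under normal data -/

theorem piecewiseLinear_eq {ρ : ℝ} (hρ : 0 < ρ) (t : ℝ) :
    piecewiseLinear ρ t = (max (t + ρ) 0 - max (t - ρ) 0) / (2 * ρ) := by
  rw [piecewiseLinear]
  split_ifs with h1 h2
  · rw [max_eq_right (by linarith), max_eq_right (by linarith)]; simp
  · rw [max_eq_left (by linarith), max_eq_right (by linarith)]; simp
  · rw [max_eq_left (by linarith), max_eq_left (by linarith)]
    field_simp
    ring

theorem measurable_piecewiseLinear (ρ : ℝ) : Measurable (piecewiseLinear ρ) :=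
  Measurable.ite measurableSet_Iio measurable_const
    (Measurable.ite measurableSet_Iic (by fun_prop) measurable_const)

theorem piecewiseLinear_mem_Icc {ρ : ℝ} (hρ : 0 < ρ) (t : ℝ) :
    piecewiseLinear ρ t ∈ Set.Icc (0 : ℝ) 1 := by
  rw [piecewiseLinear]
  split_ifs with h1 h2
  · simp
  · exact ⟨div_nonneg (by linarith) (by linarith), (div_le_one (by linarith)).2 (by linarith)⟩
  · simp

theorem integral_piecewiseLinear {ρ σ : ℝ} (hρ : 0 < ρ) (hσ : 0 < σ) (x : ℝ) :
    ∫ z, piecewiseLinear ρ (x + σ * z) ∂(gaussianReal 0 1) = smoothedCDF (ρ / σ) (x / σ) := by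
  have h : ∀ z, piecewiseLinear ρ (x + σ * z) =
      (max (x / σ + ρ / σ + z) 0 - max (x / σ - ρ / σ + z) 0) / (2 * (ρ / σ)) := fun z => by
    have e1 : max (x + σ * z + ρ) 0 = σ * max (x / σ + ρ / σ + z) 0 := by
      rw [mul_max_of_nonneg _ _ hσ.le, mul_zero]
      congr 1
      field_simp
      ring
    have e2 : max (x + σ * z - ρ) 0 = σ * max (x / σ - ρ / σ + z) 0 := by
      rw [mul_max_of_nonneg _ _ hσ.le, mul_zero]
      congr 1
      field_simp
      ring
    rw [piecewiseLinear_eq hρ, e1, e2]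
    field_simp
  simp_rw [h]
  rw [integral_div, integral_sub (integrable_posPart_gaussianReal _)
    (integrable_posPart_gaussianReal _), integral_posPart_gaussianReal,
    integral_posPart_gaussianReal, smoothedCDF]

theorem map_mul_gaussianReal (σ : ℝ) :
    (gaussianReal 0 1).map (fun z => σ * z) = gaussianReal 0 (σ ^ 2).toNNReal := by
  rw [gaussianReal_map_const_mul, mul_zero, mul_one]
  congr 1
  exact NNReal.eq (Real.coe_toNNReal _ (sq_nonneg σ)).symm

theorem gaussianReal_real_Iic {σ : ℝ} (hσ : 0 < σ) (x : ℝ) :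
    (gaussianReal 0 (σ ^ 2).toNNReal).real (Set.Iic x) = stdNormalCDF (x / σ) := by
  rw [← map_mul_gaussianReal, map_measureReal_apply (by fun_prop) measurableSet_Iic,
    stdNormalCDF_eq_real]
  congr 1
  ext z
  simp [le_div_iff₀ hσ, mul_comm]

/-- A normal distribution function of a normal variable averages to a wider normal distribution
function: the left side is the probability that `τ Z' ≤ x + σ Z`, for independent standard normal
`Z` and `Z'`. -/
theorem integral_stdNormalCDF {σ τ : ℝ} (hσ : 0 < σ) (hτ : 0 < τ) (x : ℝ) :
    ∫ z, stdNormalCDF ((x + σ * z) / τ) ∂(gaussianReal 0 1) =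
      stdNormalCDF (x / √(σ ^ 2 + τ ^ 2)) := by
  have hpos : 0 < √(σ ^ 2 + τ ^ 2) := by positivity
  set a : NNReal := (σ ^ 2).toNNReal with ha
  set b : NNReal := (τ ^ 2).toNNReal
  have hconv := gaussianReal_conv_gaussianReal (m₁ := 0) (m₂ := 0) (v₁ := a) (v₂ := b)
  have hab : a + b = (√(σ ^ 2 + τ ^ 2) ^ 2).toNNReal := by
    rw [Real.sq_sqrt (by positivity), Real.toNNReal_add (sq_nonneg σ) (sq_nonneg τ)]
  rw [add_zero, hab] at hconv
  rw [← gaussianReal_real_Iic hpos, ← hconv]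
  -- the variable `-σ Z`, of the same law as `σ Z`, brings the convolution into the required form
  have hneg : gaussianReal 0 a = (gaussianReal 0 1).map (fun z => -σ * z) := by
    rw [map_mul_gaussianReal, neg_sq]
  rw [measureReal_def, Measure.conv, Measure.map_apply (by fun_prop) measurableSet_Iic,
    Measure.prod_apply (measurableSet_Iic.preimage (by fun_prop)), hneg,
    lintegral_map (measurable_measure_prodMk_left (measurableSet_Iic.preimage (by fun_prop)))
      (by fun_prop),
    ← integral_toReal]
  · refine integral_congr_ae (.of_forall fun z => ?_)
    simp only
    rw [← gaussianReal_real_Iic hτ, measureReal_def]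
    congr 2
    ext y
    simp only [Set.mem_Iic, Set.mem_preimage]
    constructor <;> intro h <;> linarith
  · exact ((measurable_measure_prodMk_left
      (measurableSet_Iic.preimage (by fun_prop))).comp (by fun_prop)).aemeasurable
  · exact .of_forall fun z => measure_lt_top _ _

/-! ### The half-width equation -/

/-- The function `H ρ = a ρ - 1/2 + Φ(-ρ/σ)` vanishes at `0`, is initially decreasing, and is
positive at `1/(2a)`; it has a zero in between. By Rolle's theorem a second one would give two
critical points of `H`, but its derivative `a - φ(ρ/σ)/σ` is strictly increasing. -/
theorem existsUnique_halfWidth {a σ : ℝ} (ha : 0 < a) (hσ : 0 < σ)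
    (h : a * σ < gaussianPDFReal 0 1 0) :
    ∃! ρ, ρ ∈ Set.Ioo 0 (1 / (2 * a)) ∧ a * ρ - 1 / 2 + stdNormalCDF (-ρ / σ) = 0 := by
  set H : ℝ → ℝ := fun ρ => a * ρ - 1 / 2 + stdNormalCDF (-ρ / σ) with hH
  have hd : ∀ ρ, HasDerivAt H (a - gaussianPDFReal 0 1 (ρ / σ) / σ) ρ := fun ρ => by
    have h1 : HasDerivAt (fun ρ : ℝ => -ρ / σ) (-1 / σ) ρ := (hasDerivAt_id ρ).neg.div_const σ
    have h2 := (hasDerivAt_stdNormalCDF (-ρ / σ)).comp ρ h1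
    refine ((((hasDerivAt_id ρ).const_mul a).sub_const (1 / 2)).add h2).congr_deriv ?_
    rw [neg_div, stdNormalPDF_neg]
    ring
  have hc : Continuous H := continuous_iff_continuousAt.2 fun x => (hd x).continuousAt
  have h0 : H 0 = 0 := by simp [hH, stdNormalCDF_zero]
  have hm : 0 < 1 / (2 * a) := by positivity
  obtain ⟨x, hx, hx'⟩ : ∃ x ∈ Set.Ioo 0 (1 / (2 * a)), H x < 0 := by
    have hneg : a - gaussianPDFReal 0 1 (0 / σ) / σ < 0 := by
      rw [zero_div, sub_neg, lt_div_iff₀ hσ]; exact h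
    have h1 := (hd 0).tendsto_slope_zero_right.eventually (gt_mem_nhds hneg)
    have h2 : ∀ᶠ t : ℝ in 𝓝[>] 0, t ∈ Set.Ioo 0 (1 / (2 * a)) := Ioo_mem_nhdsGT hm
    obtain ⟨t, ht, ht'⟩ := (h1.and h2).exists
    refine ⟨t, ht', ?_⟩
    rw [zero_add, h0, sub_zero, smul_eq_mul] at ht
    have := ht'.1
    by_contra hcon
    have : 0 ≤ t⁻¹ * H t := mul_nonneg (inv_pos.2 this).le (not_lt.1 hcon)
    linarith
  have hend : 0 < H (1 / (2 * a)) := by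
    have : H (1 / (2 * a)) = stdNormalCDF (-(1 / (2 * a)) / σ) := by
      simp only [hH]; field_simp; ring
    rw [this]; exact stdNormalCDF_pos _
  obtain ⟨ρ, hρ, hρ0⟩ := intermediate_value_Ioo hx.2.le hc.continuousOn ⟨hx', hend⟩
  refine ⟨ρ, ⟨⟨hx.1.trans hρ.1, hρ.2⟩, hρ0⟩, ?_⟩
  have key : ∀ x y, 0 < x → x < y → H x = 0 → H y = 0 → False := by
    intro x y hx hxy hHx hHy
    obtain ⟨c, hc1, hc1'⟩ := exists_hasDerivAt_eq_zero hx hc.continuousOn (h0.trans hHx.symm)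
      fun z _ => hd z
    obtain ⟨d, hd1, hd1'⟩ := exists_hasDerivAt_eq_zero hxy hc.continuousOn (hHx.trans hHy.symm)
      fun z _ => hd z
    have hcd : c < d := hc1.2.trans hd1.1
    have : gaussianPDFReal 0 1 (d / σ) < gaussianPDFReal 0 1 (c / σ) := by
      simp only [gaussianPDFReal_zero_one_apply]
      refine mul_lt_mul_of_pos_left (Real.exp_lt_exp.2 ?_) (by positivity)
      have h1 : c / σ < d / σ := div_lt_div_of_pos_right hcd hσ
      have h2 : 0 < c / σ := div_pos hc1.1 hσ
      nlinarith
    have := div_lt_div_of_pos_right this hσ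
    linarith
  rintro y ⟨hy, hy0⟩
  rcases lt_trichotomy y ρ with hlt | heq | hgt
  · exact (key y ρ hy.1 hlt hy0 hρ0).elim
  · exact heq
  · exact (key ρ y (hx.1.trans hρ.1) hgt hρ0 hy0).elim

namespace TreatmentProblem

variable {V : Type*} [AddCommGroup V] [Module ℝ V] {n : ℕ} (P : TreatmentProblem V n)

/-! ### The law of a linear index of the data -/

theorem dotProduct_mulVec_pos {w : EuclideanSpace ℝ (Fin n)} (hw : w ≠ 0) :
    0 < w.ofLp ⬝ᵥ P.S.mulVec w.ofLp := by
  have h : w.ofLp ≠ 0 := fun h => hw (by ext i; simp [h])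
  simpa using P.posDef.dotProduct_mulVec_pos h

theorem sd_pos {w : EuclideanSpace ℝ (Fin n)} (hw : w ≠ 0) : 0 < P.sd w :=
  Real.sqrt_pos.2 (P.dotProduct_mulVec_pos hw)

theorem sd_smul (c : ℝ) (w : EuclideanSpace ℝ (Fin n)) : P.sd (c • w) = |c| * P.sd w := by
  rw [sd, sd, ← Real.sqrt_sq_eq_abs, ← Real.sqrt_mul (sq_nonneg c)]
  congr 1
  simp [Matrix.mulVec_smul]
  ring

theorem sq_sd (w : EuclideanSpace ℝ (Fin n)) : P.sd w ^ 2 = w.ofLp ⬝ᵥ P.S.mulVec w.ofLp := by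
  rcases eq_or_ne w 0 with rfl | hw
  · simp [sd]
  · exact Real.sq_sqrt (P.dotProduct_mulVec_pos hw).le

/-- The index `wᵀY` is normal with mean `wᵀμ` and standard deviation `P.sd w`. -/
theorem map_inner_multivariateGaussian (w μ : EuclideanSpace ℝ (Fin n)) :
    (multivariateGaussian μ P.S).map (fun y => (inner ℝ w y : ℝ)) =
      (gaussianReal 0 1).map (fun z => inner ℝ w μ + P.sd w * z) := by
  have h1 : (fun y => (inner ℝ w y : ℝ)) = ⇑(innerSL ℝ w) := by
    funext y; simp
  have h2 : (fun z => (inner ℝ w μ : ℝ) + P.sd w * z) =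
      (fun z => (inner ℝ w μ : ℝ) + z) ∘ (fun z => P.sd w * z) := rfl
  have hvar : Var[⇑(innerSL ℝ w); multivariateGaussian μ P.S] = P.sd w ^ 2 := by
    rw [sq_sd, ← covarianceBilin_multivariateGaussian (μ := μ) P.posDef.posSemidef,
      covarianceBilin_self IsGaussian.memLp_two_id, h1]
  have hmean : (multivariateGaussian μ P.S)[⇑(innerSL ℝ w)] = inner ℝ w μ := by
    rw [(innerSL ℝ w).integral_comp_id_comm IsGaussian.integrable_id]
    simp
  rw [h1, IsGaussian.map_eq_gaussianReal, hvar, hmean, h2, ← Measure.map_map (by fun_prop)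
    (by fun_prop), map_mul_gaussianReal, gaussianReal_map_const_add, zero_add]

theorem expect_index {f : ℝ → ℝ} (hf : Measurable f) (w μ : EuclideanSpace ℝ (Fin n)) :
    P.expect μ (fun y => f (inner ℝ w y)) =
      ∫ z, f (inner ℝ w μ + P.sd w * z) ∂(gaussianReal 0 1) := by
  rw [expect, ← integral_map (φ := fun y => (inner ℝ w y : ℝ)) (by fun_prop)
    hf.aestronglyMeasurable, P.map_inner_multivariateGaussian,
    integral_map (by fun_prop) hf.aestronglyMeasurable]

theorem integrable_of_mem_decisionRules {d : EuclideanSpace ℝ (Fin n) → ℝ}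
    (hd : d ∈ decisionRules n) (μ : EuclideanSpace ℝ (Fin n)) :
    Integrable d (multivariateGaussian μ P.S) :=
  .of_bound hd.1.aestronglyMeasurable 1 (.of_forall fun y => by
    rw [Real.norm_of_nonneg (hd.2 y).1]; exact (hd.2 y).2)

theorem expect_mem_Icc {d : EuclideanSpace ℝ (Fin n) → ℝ} (hd : d ∈ decisionRules n)
    (μ : EuclideanSpace ℝ (Fin n)) : P.expect μ d ∈ Set.Icc (0 : ℝ) 1 := by
  refine ⟨integral_nonneg fun y => (hd.2 y).1, ?_⟩
  have := integral_mono (P.integrable_of_mem_decisionRules hd μ) (integrable_const 1)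
    fun y => (hd.2 y).2
  simpa [expect] using this

/-- A rule that jumps from `0` to `1` where the index crosses `c`; the value at `c` itself is
immaterial, since the index has no atoms. -/
theorem expect_indicator {f : ℝ → ℝ} {v : EuclideanSpace ℝ (Fin n)} {c : ℝ} (hv : v ≠ 0)
    (hf0 : ∀ t < c, f t = 0) (hf1 : ∀ t > c, f t = 1) (μ : EuclideanSpace ℝ (Fin n)) :
    P.expect μ (fun y => f (inner ℝ v y)) = stdNormalCDF ((inner ℝ v μ - c) / P.sd v) := by
  have hfm : Measurable f := by
    have : f = fun t => if t < c then 0 else if t ≤ c then f c else 1 := by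
      funext t
      rcases lt_trichotomy t c with h | rfl | h
      · rw [if_pos h, hf0 t h]
      · simp
      · rw [if_neg h.not_gt, if_neg h.not_ge, hf1 t h]
    rw [this]
    exact Measurable.ite measurableSet_Iio measurable_const
      (Measurable.ite measurableSet_Iic measurable_const measurable_const)
  have hσ := P.sd_pos hv
  have := nullSingletonClass_gaussianReal (μ := 0) (v := 1) one_ne_zero
  set a : ℝ := (c - inner ℝ v μ) / P.sd v with ha
  have hae : (fun z => f (inner ℝ v μ + P.sd v * z)) =ᵐ[gaussianReal 0 1]
      (Set.Ioi a).indicator 1 := by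
    filter_upwards [Measure.ae_ne (gaussianReal 0 1) a] with z hz
    rcases lt_or_gt_of_ne hz with h | h
    · rw [Set.indicator_of_notMem (by simpa using h.le)]
      rw [ha, lt_div_iff₀ hσ] at h
      exact hf0 _ (by linarith)
    · rw [Set.indicator_of_mem (Set.mem_Ioi.2 h)]
      rw [ha, div_lt_iff₀ hσ] at h
      exact hf1 _ (by linarith)
  rw [P.expect_index hfm, integral_congr_ae hae, integral_indicator_one measurableSet_Ioi,
    gaussianReal_real_Ioi, ha, ← neg_div, neg_sub]

/-! ### Regret and its minimax value -/

theorem regret_of_nonneg {d : EuclideanSpace ℝ (Fin n) → ℝ} {θ : V} (h : 0 ≤ P.U θ) :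
    P.regret d θ = P.U θ * (1 - P.expect (P.m θ) d) := by simp [regret, h]

theorem regret_of_neg {d : EuclideanSpace ℝ (Fin n) → ℝ} {θ : V} (h : P.U θ < 0) :
    P.regret d θ = -P.U θ * P.expect (P.m θ) d := by simp [regret, h.not_ge]

variable {P}

theorem IsLinearSymmetric.zero_mem (h : P.IsLinearSymmetric) : (0 : V) ∈ P.Θ := by
  obtain ⟨θ, hθ⟩ := h.nonempty
  have := h.convex hθ (h.neg_mem θ hθ) (a := 1 / 2) (b := 1 / 2) (by norm_num) (by norm_num)
    (by norm_num)
  simpa using this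

theorem IsLinearSymmetric.combo (h : P.IsLinearSymmetric) {θ θ' : V} (hθ : θ ∈ P.Θ)
    (hθ' : θ' ∈ P.Θ) {a b : ℝ} (ha : 0 ≤ a) (hb : 0 ≤ b) (hab : a + b = 1) :
    a • θ + b • θ' ∈ P.Θ ∧ P.m (a • θ + b • θ') = a • P.m θ + b • P.m θ' ∧
      P.U (a • θ + b • θ') = a * P.U θ + b * P.U θ' := by
  have hmem := h.convex hθ hθ' ha hb hab
  obtain ⟨L, hL⟩ := h.linear_m
  obtain ⟨K, hK⟩ := h.linear_U
  refine ⟨hmem, ?_, ?_⟩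
  · rw [hL _ hmem, hL _ hθ, hL _ hθ', map_add, map_smul, map_smul]
  · rw [hK _ hmem, hK _ hθ, hK _ hθ', map_add, map_smul, map_smul, smul_eq_mul, smul_eq_mul]

theorem IsLinearSymmetric.m_zero (h : P.IsLinearSymmetric) : P.m 0 = 0 := by
  obtain ⟨L, hL⟩ := h.linear_m
  rw [hL _ h.zero_mem, map_zero]

theorem IsLinearSymmetric.m_neg (h : P.IsLinearSymmetric) {θ : V} (hθ : θ ∈ P.Θ) :
    P.m (-θ) = -P.m θ := by
  obtain ⟨L, hL⟩ := h.linear_m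
  rw [hL _ hθ, hL _ (h.neg_mem θ hθ), map_neg]

theorem IsLinearSymmetric.U_neg (h : P.IsLinearSymmetric) {θ : V} (hθ : θ ∈ P.Θ) :
    P.U (-θ) = -P.U θ := by
  obtain ⟨L, hL⟩ := h.linear_U
  rw [hL _ hθ, hL _ (h.neg_mem θ hθ), map_neg]

theorem IsLinearSymmetric.U_zero (h : P.IsLinearSymmetric) : P.U 0 = 0 := by
  obtain ⟨L, hL⟩ := h.linear_U
  rw [hL _ h.zero_mem, map_zero]

/-- By convexity and symmetry, `0` is interior to `M` as soon as `M` has an interior point. -/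
theorem IsLinearSymmetric.M_mem_nhds (h : P.IsLinearSymmetric) (hpid : P.NontrivialPartialId) :
    P.M ∈ 𝓝 (0 : EuclideanSpace ℝ (Fin n)) := by
  obtain ⟨O, hO, ⟨x, hx⟩, hOM, -⟩ := hpid
  have hc : ContinuousAt (fun μ : EuclideanSpace ℝ (Fin n) => x + (2 : ℝ) • μ) 0 := by fun_prop
  have hmem : O ∈ 𝓝 (x + (2 : ℝ) • (0 : EuclideanSpace ℝ (Fin n))) := by
    rw [smul_zero, add_zero]; exact hO.mem_nhds hx
  filter_upwards [hc hmem] with μ hμ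
  obtain ⟨θ, hθ, hθμ⟩ := hOM hμ
  obtain ⟨θ', hθ', hθx⟩ := hOM hx
  obtain ⟨h1, h2, -⟩ := h.combo hθ (h.neg_mem θ' hθ') (a := 1 / 2) (b := 1 / 2) (by norm_num)
    (by norm_num) (by norm_num)
  refine ⟨_, h1, ?_⟩
  rw [h2, h.m_neg hθ', hθμ, hθx]
  module

/-- Every rule has worst-case regret at least half of any welfare contrast compatible with mean
zero: the states `θ` and `-θ` are then indistinguishable, and their regrets add up to `|U θ|`. -/
theorem IsLinearSymmetric.half_le_worstRegret (h : P.IsLinearSymmetric)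
    (d : EuclideanSpace ℝ (Fin n) → ℝ) {θ : V} (hθ : θ ∈ P.Θ) (hm : P.m θ = 0) :
    ((P.U θ / 2 : ℝ) : EReal) ≤ P.worstRegret d := by
  have hle : ∀ θ ∈ P.Θ, (P.regret d θ : EReal) ≤ P.worstRegret d := fun θ hθ =>
    le_iSup₂ (f := fun θ (_ : θ ∈ P.Θ) => (P.regret d θ : EReal)) θ hθ
  rcases le_or_gt (P.U θ) 0 with hU | hU
  · refine le_trans (EReal.coe_le_coe_iff.2 ?_) (hle 0 h.zero_mem)
    simp only [regret, h.U_zero, zero_mul]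
    linarith
  · have h1 := P.regret_of_nonneg (d := d) hU.le
    have h2 := P.regret_of_neg (d := d) (θ := -θ) (by rw [h.U_neg hθ]; linarith)
    rw [h.m_neg hθ, h.U_neg hθ, hm, neg_zero, neg_neg] at h2
    rw [hm] at h1
    rcases le_total (P.expect 0 d) (1 / 2) with hp | hp
    · refine le_trans (EReal.coe_le_coe_iff.2 ?_) (hle θ hθ)
      rw [h1]; nlinarith
    · refine le_trans (EReal.coe_le_coe_iff.2 ?_) (hle (-θ) (h.neg_mem θ hθ))
      rw [h2]; nlinarith

variable (P) in
/-- The number `k` is the largest welfare contrast compatible with `m(θ) = 0`, and also the largest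
one compatible with `wᵀm(θ) = 0`; the minimax value of regret is `k / 2`; and the welfare contrast
lies below the line through `k` of slope `s` in the index `wᵀm(θ)`. -/
structure HasTangent (w : EuclideanSpace ℝ (Fin n)) (k s : ℝ) : Prop where
  upperI_zero : P.upperI 0 = k
  kbar_zero : P.kbar w 0 = k
  isMMR_iff : ∀ d, P.IsMMR d ↔ d ∈ decisionRules n ∧ ∀ θ ∈ P.Θ, P.regret d θ ≤ k / 2
  U_le : ∀ θ ∈ P.Θ, P.U θ ≤ k + s * inner ℝ w (P.m θ)
  U_approx : ∀ k' < k, ∃ θ ∈ P.Θ, P.m θ = 0 ∧ k' < P.U θ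

theorem U_le_upperI {θ : V} (hθ : θ ∈ P.Θ) : (P.U θ : EReal) ≤ P.upperI (P.m θ) :=
  le_iSup₂ (f := fun u (_ : u ∈ P.idSet (P.m θ)) => (u : EReal)) (P.U θ) ⟨θ, hθ, rfl, rfl⟩

theorem U_le_kbar (w : EuclideanSpace ℝ (Fin n)) {θ : V} (hθ : θ ∈ P.Θ) :
    (P.U θ : EReal) ≤ P.kbar w (inner ℝ w (P.m θ)) :=
  le_iSup₂ (f := fun θ' (_ : θ' ∈ {θ' ∈ P.Θ | inner ℝ w (P.m θ') = inner ℝ w (P.m θ)}) =>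
    (P.U θ' : EReal)) θ ⟨hθ, rfl⟩

/-- The given index rule attains the lower bound `k / 2` on worst-case regret, which is therefore
the minimax value. A supergradient `s = 0` would contradict that some mean allows a larger welfare
contrast than `0` does. -/
theorem IsLinearSymmetric.exists_hasTangent (hlin : P.IsLinearSymmetric)
    {w : EuclideanSpace ℝ (Fin n)}
    (hd : ∃ d : EuclideanSpace ℝ (Fin n) → ℝ, P.IsMMR d ∧ DependsThrough w d ∧
      (∀ θ ∈ P.Θ, P.m θ = 0 → P.expect (P.m θ) d = 1 / 2) ∧
      P.worstRegret d = ⨆ θ ∈ {θ ∈ P.Θ | P.m θ = 0}, (P.regret d θ : EReal))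
    (hgt : ∃ μ ∈ P.M, P.upperI 0 < P.upperI μ) {s : ℝ} (hs : s ∈ P.superdiff w) :
    ∃ k : ℝ, P.HasTangent w k s ∧ s ≠ 0 := by
  obtain ⟨d, hdM, ⟨f, hfm, hf01, hdf⟩, hhalf, hworst⟩ := hd
  obtain ⟨μ, hμM, hμ⟩ := hgt
  have h0U : (0 : EReal) ≤ P.upperI 0 := by
    have := U_le_upperI hlin.zero_mem
    rwa [hlin.m_zero, hlin.U_zero, EReal.coe_zero] at this
  obtain ⟨k, hk⟩ : ∃ k : ℝ, P.upperI 0 = k :=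
    ⟨_, (EReal.coe_toReal (hμ.trans_le le_top).ne (ne_bot_of_le_ne_bot (by simp) h0U)).symm⟩
  have hUk : ∀ θ ∈ P.Θ, P.m θ = 0 → P.U θ ≤ k := fun θ hθ hm => by
    have := U_le_upperI hθ
    rwa [hm, hk, EReal.coe_le_coe_iff] at this
  have happrox : ∀ k' < k, ∃ θ ∈ P.Θ, P.m θ = 0 ∧ k' < P.U θ := fun k' hk' => by
    have : (k' : EReal) < P.upperI 0 := by rw [hk]; exact EReal.coe_lt_coe_iff.2 hk'
    rw [upperI, lt_iSup_iff] at this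
    obtain ⟨u, hu⟩ := this
    obtain ⟨⟨θ, hθ, hm, rfl⟩, hlt⟩ := lt_iSup_iff.1 hu
    exact ⟨θ, hθ, hm, EReal.coe_lt_coe_iff.1 hlt⟩
  have hlower : ∀ d, ((k / 2 : ℝ) : EReal) ≤ P.worstRegret d := fun d => by
    refine EReal.ge_of_forall_gt_iff_ge.1 fun z hz => ?_
    obtain ⟨θ, hθ, hm, hlt⟩ := happrox (2 * z) (by linarith [EReal.coe_lt_coe_iff.1 hz])
    exact (EReal.coe_le_coe_iff.2 (by linarith)).trans (hlin.half_le_worstRegret d hθ hm)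
  have hle : ∀ (d : EuclideanSpace ℝ (Fin n) → ℝ), P.worstRegret d ≤ ((k / 2 : ℝ) : EReal) ↔
      ∀ θ ∈ P.Θ, P.regret d θ ≤ k / 2 := fun d => by
    simp only [worstRegret, iSup_le_iff, EReal.coe_le_coe_iff]
  have hdle : P.worstRegret d ≤ ((k / 2 : ℝ) : EReal) := by
    rw [hworst]
    refine iSup₂_le fun θ hθ => EReal.coe_le_coe_iff.2 ?_
    have hE := hhalf θ hθ.1 hθ.2
    rcases le_or_gt 0 (P.U θ) with hU | hU
    · rw [P.regret_of_nonneg hU, hE]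
      linarith [hUk θ hθ.1 hθ.2]
    · rw [P.regret_of_neg hU, hE]
      have := hUk (-θ) (hlin.neg_mem θ hθ.1) (by rw [hlin.m_neg hθ.1, hθ.2, neg_zero])
      rw [hlin.U_neg hθ.1] at this
      linarith
  have hval : (⨅ d' ∈ decisionRules n, P.worstRegret d') = ((k / 2 : ℝ) : EReal) :=
    le_antisymm (hdM.2 ▸ hdle) (le_iInf₂ fun d' _ => hlower d')
  -- the rule depends on the index only, so that it has mean `1/2` in every state with `wᵀm(θ) = 0`,
  -- where its regret is `U θ / 2` if `U θ ≥ 0`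
  have hkbar : P.kbar w 0 = k := by
    refine le_antisymm (iSup₂_le fun θ hθ => EReal.coe_le_coe_iff.2 ?_) ?_
    · have hE : P.expect (P.m θ) d = 1 / 2 := by
        have h0 := hhalf 0 hlin.zero_mem hlin.m_zero
        rw [hlin.m_zero] at h0
        rw [← h0, funext hdf, P.expect_index hfm, P.expect_index hfm, hθ.2, inner_zero_right]
      rcases le_or_gt 0 (P.U θ) with hU | hU
      · have := (hle d).1 hdle θ hθ.1
        rw [P.regret_of_nonneg hU, hE] at this
        linarith
      · have : (0 : ℝ) ≤ k := by rwa [hk, ← EReal.coe_zero, EReal.coe_le_coe_iff] at h0U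
        linarith
    · rw [← hk]
      refine iSup₂_le fun u hu => ?_
      obtain ⟨θ, hθ, hm, rfl⟩ := hu
      have := U_le_kbar w hθ
      rwa [hm, inner_zero_right] at this
  have hUle : ∀ θ ∈ P.Θ, P.U θ ≤ k + s * inner ℝ w (P.m θ) := fun θ hθ => by
    have := (U_le_kbar w hθ).trans (hs _ ⟨θ, hθ, rfl⟩)
    rwa [hkbar, ← EReal.coe_add, EReal.coe_le_coe_iff] at this
  refine ⟨k, ⟨hk, hkbar, fun d' => ?_, hUle, happrox⟩, ?_⟩
  · rw [IsMMR, hval, ← hle, and_congr_right_iff]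
    exact fun _ => ⟨fun h => h.le, fun h => le_antisymm h (hlower d')⟩
  · rintro rfl
    refine hμ.not_ge ?_
    rw [hk]
    refine iSup₂_le fun u hu => ?_
    obtain ⟨θ, hθ, -, rfl⟩ := hu
    have := hUle θ hθ
    rw [zero_mul, add_zero] at this
    exact EReal.coe_le_coe_iff.2 this

variable {w : EuclideanSpace ℝ (Fin n)} {k s : ℝ}

/-! ### Optimal index rules -/

/-- An index rule `F` with mean `e` is minimax-regret optimal if `e` is symmetric and its survival
function satisfies the bound of `one_add_mul_one_sub_le_half` with slope `|s| / k`: the welfare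
contrast is at most `k (1 + |s| / k * x)` in the state whose index, oriented by the sign of `s`,
is `x`. -/
theorem HasTangent.isMMR_index (h : P.HasTangent w k s) (hlin : P.IsLinearSymmetric) (hk : 0 < k)
    (hs0 : s ≠ 0) {F e : ℝ → ℝ} (hF : Measurable F) (hF01 : ∀ t, F t ∈ Set.Icc (0 : ℝ) 1)
    (he : ∀ x, ∫ z, F (x + P.sd w * z) ∂(gaussianReal 0 1) = e x)
    (hsymm : ∀ x, e (-x) = 1 - e x) (htail : ∀ x, (1 + |s| / k * x) * (1 - e x) ≤ 1 / 2) :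
    P.IsMMR fun y => F (Real.sign s * inner ℝ w y) := by
  have hrule : (fun y => F (Real.sign s * inner ℝ w y)) ∈ decisionRules n :=
    ⟨hF.comp (by fun_prop), fun y => hF01 _⟩
  refine (h.isMMR_iff _).2 ⟨hrule, ?_⟩
  set d : EuclideanSpace ℝ (Fin n) → ℝ := fun y => F (Real.sign s * inner ℝ w y) with hd
  have hsign : |Real.sign s| = 1 := by
    rcases Real.sign_apply_eq_of_ne_zero s hs0 with h | h <;> simp [h]
  have hsd : P.sd (Real.sign s • w) = P.sd w := by rw [sd_smul, hsign, one_mul]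
  have hE : ∀ μ, P.expect μ d = e (Real.sign s * inner ℝ w μ) := fun μ => by
    have hd' : d = fun y => F (inner ℝ (Real.sign s • w) y) := by
      funext y; rw [hd, real_inner_smul_left]
    rw [hd', P.expect_index hF, hsd, he, real_inner_smul_left]
  have hnonneg : ∀ θ ∈ P.Θ, P.U θ * (1 - P.expect (P.m θ) d) ≤ k / 2 := fun θ hθ => by
    have h1 : P.U θ ≤ k * (1 + |s| / k * (Real.sign s * inner ℝ w (P.m θ))) := by
      have hss : |s| * Real.sign s = s := by
        rcases lt_or_gt_of_ne hs0 with h | h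
        · rw [abs_of_neg h, Real.sign_of_neg h]; ring
        · rw [abs_of_pos h, Real.sign_of_pos h, mul_one]
      refine (h.U_le θ hθ).trans_eq ?_
      calc k + s * inner ℝ w (P.m θ) = k + |s| * Real.sign s * inner ℝ w (P.m θ) := by rw [hss]
        _ = _ := by field_simp
    have h2 := (P.expect_mem_Icc hrule (P.m θ)).2
    have h3 := htail (Real.sign s * inner ℝ w (P.m θ))
    rw [← hE] at h3
    calc _ ≤ _ := mul_le_mul_of_nonneg_right h1 (sub_nonneg.2 h2)
      _ ≤ k / 2 := by rw [mul_assoc]; nlinarith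
  intro θ hθ
  rcases le_or_gt 0 (P.U θ) with hU | hU
  · rw [P.regret_of_nonneg hU]
    exact hnonneg θ hθ
  · have h1 := hnonneg (-θ) (hlin.neg_mem θ hθ)
    rw [hE, hlin.m_neg hθ, inner_neg_right, mul_neg, hsymm, hlin.U_neg hθ, sub_sub_cancel,
      ← hE] at h1
    rwa [P.regret_of_neg hU]

/-- By the half-width equation, twice the density at `0` of the distribution function of the index
plus uniform noise on `[-ρ, ρ]` matches the slope `|s| / k`. -/
theorem HasTangent.isMMR_piecewiseLinear (h : P.HasTangent w k s) (hlin : P.IsLinearSymmetric)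
    (hk : 0 < k) (hw : w ≠ 0) (hs0 : s ≠ 0) {ρ : ℝ} (hρ : P.IsHalfWidth w |s| ρ) :
    P.IsMMR fun y => piecewiseLinear ρ (Real.sign s * inner ℝ w y) := by
  have hσ := P.sd_pos hw
  obtain ⟨⟨hρ0, -⟩, heq⟩ := hρ
  rw [h.kbar_zero, EReal.toReal_coe] at heq
  have hr : 0 < ρ / P.sd w := div_pos hρ0 hσ
  refine h.isMMR_index hlin hk hs0 (measurable_piecewiseLinear ρ) (piecewiseLinear_mem_Icc hρ0)
    (integral_piecewiseLinear hρ0 hσ) (fun x => ?_) fun x => ?_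
  · rw [neg_div, smoothedCDF_neg hr]
  · have h1 := one_add_mul_one_sub_smoothedCDF_le hr (x / P.sd w)
    have h2 : 2 * smoothedPDF (ρ / P.sd w) 0 * (x / P.sd w) = |s| / k * x := by
      rw [smoothedPDF, zero_add, zero_sub]
      have h3 : stdNormalCDF (ρ / P.sd w) - stdNormalCDF (-(ρ / P.sd w)) = |s| / k * ρ := by
        have h4 := stdNormalCDF_neg (ρ / P.sd w)
        rw [neg_div] at heq
        have h5 : |s| / k * ρ = 2 * (|s| / (2 * k) * ρ) := by field_simp
        linarith
      rw [h3]
      field_simp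
    rwa [h2] at h1

/-- A normal distribution function of the index is optimal too, if its scale is chosen such that the
mean is `x ↦ Φ(x / σ')` with `σ' = 2 φ(0) k / |s|`. Such a scale exists because `σ'` exceeds the
standard deviation of the index. -/
theorem HasTangent.isMMR_normalCDF (h : P.HasTangent w k s) (hlin : P.IsLinearSymmetric)
    (hk : 0 < k) (hw : w ≠ 0) (hs0 : s ≠ 0)
    (hlarge : |s| * P.sd w < 2 * gaussianPDFReal 0 1 0 * k) :
    ∃ τ : ℝ, P.IsMMR fun y => stdNormalCDF (Real.sign s * inner ℝ w y / τ) := by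
  have hσ := P.sd_pos hw
  have hs := abs_pos.2 hs0
  set σ' : ℝ := 2 * gaussianPDFReal 0 1 0 * k / |s| with hσ'
  have hlt : P.sd w < σ' := by rw [hσ', lt_div_iff₀ hs, mul_comm]; exact hlarge
  have hσ'pos : 0 < σ' := hσ.trans hlt
  have hpos : 0 < σ' ^ 2 - P.sd w ^ 2 := by nlinarith
  have hτ : 0 < √(σ' ^ 2 - P.sd w ^ 2) := Real.sqrt_pos.2 hpos
  have hsum : √(P.sd w ^ 2 + √(σ' ^ 2 - P.sd w ^ 2) ^ 2) = σ' := by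
    rw [Real.sq_sqrt hpos.le, add_sub_cancel, Real.sqrt_sq hσ'pos.le]
  refine ⟨√(σ' ^ 2 - P.sd w ^ 2), h.isMMR_index hlin hk hs0
    (F := fun t => stdNormalCDF (t / √(σ' ^ 2 - P.sd w ^ 2))) (e := fun x => stdNormalCDF (x / σ'))
    (continuous_stdNormalCDF.comp (by fun_prop)).measurable (fun t => stdNormalCDF_mem_Icc _)
    (fun x => ?_) (fun x => ?_) fun x => ?_⟩
  · rw [integral_stdNormalCDF hσ hτ, hsum]
  · simp only [neg_div, stdNormalCDF_neg]
  · have h1 := one_add_mul_one_sub_stdNormalCDF_le (x / σ')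
    have h2 : 2 * gaussianPDFReal 0 1 0 * (x / σ') = |s| / k * x := by
      have := stdNormalPDF_pos 0
      rw [hσ']
      field_simp
    rwa [h2] at h1

theorem HasTangent.isMMR_convexCombo (h : P.HasTangent w k s)
    {d₁ d₂ : EuclideanSpace ℝ (Fin n) → ℝ} (h₁ : P.IsMMR d₁) (h₂ : P.IsMMR d₂) {a : ℝ}
    (ha : a ∈ Set.Icc (0 : ℝ) 1) : P.IsMMR fun y => a * d₁ y + (1 - a) * d₂ y := by
  obtain ⟨ha0, ha1⟩ := ha
  rw [h.isMMR_iff] at h₁ h₂ ⊢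
  obtain ⟨hd₁, hr₁⟩ := h₁
  obtain ⟨hd₂, hr₂⟩ := h₂
  refine ⟨⟨(hd₁.1.const_mul a).add (hd₂.1.const_mul _), fun y => ?_⟩, fun θ hθ => ?_⟩
  · exact convex_Icc (0 : ℝ) 1 (hd₁.2 y) (hd₂.2 y) ha0 (sub_nonneg.2 ha1) (by ring)
  · have hE : P.expect (P.m θ) (fun y => a * d₁ y + (1 - a) * d₂ y) =
        a * P.expect (P.m θ) d₁ + (1 - a) * P.expect (P.m θ) d₂ := by
      rw [expect, integral_add ((P.integrable_of_mem_decisionRules hd₁ _).const_mul a)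
        ((P.integrable_of_mem_decisionRules hd₂ _).const_mul _), integral_const_mul,
        integral_const_mul]
      rfl
    have : P.regret (fun y => a * d₁ y + (1 - a) * d₂ y) θ =
        a * P.regret d₁ θ + (1 - a) * P.regret d₂ θ := by
      simp only [regret, hE]; ring
    rw [this]
    have := mul_le_mul_of_nonneg_left (hr₁ θ hθ) ha0
    have := mul_le_mul_of_nonneg_left (hr₂ θ hθ) (sub_nonneg.2 ha1)
    linarith

/-- A property that holds almost everywhere holds somewhere in the slab over any nonempty open set
of index values. -/
theorem exists_inner_mem_of_ae {w : EuclideanSpace ℝ (Fin n)} (hw : w ≠ 0)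
    {p : EuclideanSpace ℝ (Fin n) → Prop}
    (hp : ∀ᵐ y ∂(volume : Measure (EuclideanSpace ℝ (Fin n))), p y)
    {O : Set ℝ} (hO : IsOpen O) (hne : O.Nonempty) : ∃ y, inner ℝ w y ∈ O ∧ p y := by
  obtain ⟨t, ht⟩ := hne
  have hopen : IsOpen {y : EuclideanSpace ℝ (Fin n) | (inner ℝ w y : ℝ) ∈ O} :=
    hO.preimage (by fun_prop)
  have hnon : {y : EuclideanSpace ℝ (Fin n) | (inner ℝ w y : ℝ) ∈ O}.Nonempty := by
    refine ⟨(t / inner ℝ w w) • w, ?_⟩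
    have : (inner ℝ w w : ℝ) ≠ 0 := inner_self_ne_zero.2 hw
    rw [Set.mem_ofPred_eq, real_inner_smul_right, div_mul_cancel₀ _ this]
    exact ht
  obtain ⟨y, hy, hy'⟩ := (Measure.dense_of_ae hp).inter_open_nonempty _ hopen hnon
  exact ⟨y, hy, hy'⟩

/-- The sequence consists of mixtures of the piecewise linear rule and a normal distribution
function of the index. These two differ wherever the piecewise linear rule takes the value `1`. -/
theorem HasTangent.exists_seq_isMMR (h : P.HasTangent w k s) (hw : w ≠ 0) (hs0 : s ≠ 0) {ρ τ : ℝ}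
    (h₁ : P.IsMMR fun y => piecewiseLinear ρ (Real.sign s * inner ℝ w y)) (hρ : 0 < ρ)
    (h₂ : P.IsMMR fun y => stdNormalCDF (Real.sign s * inner ℝ w y / τ)) :
    ∃ f : ℕ → EuclideanSpace ℝ (Fin n) → ℝ, (∀ k, P.IsMMR (f k)) ∧
        Pairwise fun i j => ¬ f i =ᵐ[volume] f j := by
  refine ⟨fun j y => (1 / ((j : ℝ) + 1)) * piecewiseLinear ρ (Real.sign s * inner ℝ w y) +
    (1 - 1 / ((j : ℝ) + 1)) * stdNormalCDF (Real.sign s * inner ℝ w y / τ), fun j =>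
    h.isMMR_convexCombo h₁ h₂ ⟨by positivity, ?_⟩, fun i j hij heq => hij ?_⟩
  · rw [div_le_one (by positivity)]
    linarith [Nat.cast_nonneg (α := ℝ) j]
  · have hsw : Real.sign s • w ≠ 0 := smul_ne_zero (by simpa [Real.sign_eq_zero_iff] using hs0) hw
    obtain ⟨y, hy, hy'⟩ := exists_inner_mem_of_ae hsw heq isOpen_Ioi (Set.nonempty_Ioi (a := ρ))
    rw [real_inner_smul_left, Set.mem_Ioi] at hy
    have hlin : piecewiseLinear ρ (Real.sign s * inner ℝ w y) = 1 := by
      rw [piecewiseLinear, if_neg (by linarith), if_neg hy.not_ge]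
    have hlt := stdNormalCDF_lt_one (Real.sign s * inner ℝ w y / τ)
    simp only [hlin] at hy'
    have h3 : (1 / ((i : ℝ) + 1) - 1 / ((j : ℝ) + 1)) *
        (1 - stdNormalCDF (Real.sign s * inner ℝ w y / τ)) = 0 := by linarith
    rcases mul_eq_zero.1 h3 with h4 | h4
    · have : (i : ℝ) + 1 = j + 1 := by
        have := sub_eq_zero.1 h4
        simpa using this
      exact_mod_cast add_right_cancel this
    · linarith

/-! ### Rules with values zero and one -/

theorem HasTangent.U_mul_le (h : P.HasTangent w k s) (hk : 0 < k)
    {d : EuclideanSpace ℝ (Fin n) → ℝ} (hd : P.IsMMR d) {θ : V} (hθ : θ ∈ P.Θ) :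
    P.U θ * (1 - P.expect (P.m θ) d) ≤ k / 2 := by
  obtain ⟨hrule, hr⟩ := (h.isMMR_iff d).1 hd
  rcases le_or_gt 0 (P.U θ) with hU | hU
  · rw [← P.regret_of_nonneg hU]
    exact hr θ hθ
  · have := (P.expect_mem_Icc hrule (P.m θ)).2
    nlinarith

theorem HasTangent.expect_zero (h : P.HasTangent w k s) (hlin : P.IsLinearSymmetric) (hk : 0 < k)
    {d : EuclideanSpace ℝ (Fin n) → ℝ} (hd : P.IsMMR d) : P.expect 0 d = 1 / 2 := by
  have h1 : ∀ θ ∈ P.Θ, P.m θ = 0 → P.U θ * (1 - P.expect 0 d) ≤ k / 2 := fun θ hθ hm => by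
    have := h.U_mul_le hk hd hθ
    rwa [hm] at this
  have h2 : ∀ θ ∈ P.Θ, P.m θ = 0 → 0 < P.U θ → P.U θ * P.expect 0 d ≤ k / 2 :=
    fun θ hθ hm hU => by
      have h3 := ((h.isMMR_iff d).1 hd).2 (-θ) (hlin.neg_mem θ hθ)
      rwa [P.regret_of_neg (by rw [hlin.U_neg hθ]; linarith), hlin.U_neg hθ, hlin.m_neg hθ, hm,
        neg_zero, neg_neg] at h3
  have key : ∀ x : ℝ, 1 / 2 < x → ∃ θ ∈ P.Θ, P.m θ = 0 ∧ 0 < P.U θ ∧ k / 2 < P.U θ * x :=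
    fun x hx => by
      obtain ⟨θ, hθ, hm, hlt⟩ := h.U_approx (k / (2 * x)) (by
        rw [div_lt_iff₀ (by linarith)]; nlinarith)
      have hpos : 0 < k / (2 * x) := div_pos hk (by linarith)
      refine ⟨θ, hθ, hm, hpos.trans hlt, ?_⟩
      rw [div_lt_iff₀ (by linarith)] at hlt
      linarith
  rcases lt_trichotomy (P.expect 0 d) (1 / 2) with hlt | heq | hgt
  · obtain ⟨θ, hθ, hm, -, h3⟩ := key (1 - P.expect 0 d) (by linarith)
    exact absurd (h1 θ hθ hm) h3.not_ge
  · exact heq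
  · obtain ⟨θ, hθ, hm, hU, h3⟩ := key _ hgt
    exact absurd (h2 θ hθ hm hU) h3.not_ge

/-- Optimality of the rule that jumps at index `0` bounds `kbar w` by `k / (2 Φ(-γ / σ))`. The two
agree at `0`, so that, by concavity of `kbar w`, the derivative of the bound at `0` is a
supergradient. Concavity is used through mixtures of `θ` with states of mean zero. -/
theorem HasTangent.mem_superdiff (h : P.HasTangent w k s) (hlin : P.IsLinearSymmetric)
    (hk : 0 < k) {d : EuclideanSpace ℝ (Fin n) → ℝ} (hd : P.IsMMR d)
    (hE : ∀ μ, P.expect μ d = stdNormalCDF (inner ℝ w μ / P.sd w)) :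
    2 * gaussianPDFReal 0 1 0 * k / P.sd w ∈ P.superdiff w := by
  rintro γ -
  rw [h.kbar_zero, ← EReal.coe_add]
  refine iSup₂_le fun θ hθ => EReal.coe_le_coe_iff.2 ?_
  obtain ⟨hθ, hγ⟩ := hθ
  set D : ℝ → ℝ := fun t => (t * P.U θ + (1 - t) * k) * (1 - stdNormalCDF (t * γ / P.sd w)) with hD
  have hD0 : D 0 = k / 2 := by simp only [hD, zero_mul, zero_div, stdNormalCDF_zero]; ring
  have hDle : ∀ t ∈ Set.Ioo (0 : ℝ) 1, D t ≤ k / 2 := fun t ht => by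
    have hc : Continuous fun u : ℝ =>
      (t * P.U θ + (1 - t) * u) * (1 - stdNormalCDF (t * γ / P.sd w)) := by fun_prop
    refine le_of_tendsto ((hc.tendsto k).mono_left (nhdsWithin_le_nhds : 𝓝[<] k ≤ 𝓝 k)) ?_
    filter_upwards [self_mem_nhdsWithin] with u hu
    obtain ⟨θ₀, hθ₀, hm, hlt⟩ := h.U_approx u hu
    obtain ⟨h1, h2, h3⟩ := hlin.combo hθ hθ₀ ht.1.le (sub_nonneg.2 ht.2.le) (by ring)
    have h4 := h.U_mul_le hk hd h1
    rw [hE, h2, h3, hm, smul_zero, add_zero, real_inner_smul_right, hγ] at h4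
    refine le_trans (mul_le_mul_of_nonneg_right ?_ (sub_nonneg.2 (stdNormalCDF_mem_Icc _).2)) h4
    have := mul_le_mul_of_nonneg_left hlt.le (sub_nonneg.2 ht.2.le)
    linarith
  have hDd : HasDerivAt D ((P.U θ - k) / 2 - k * (gaussianPDFReal 0 1 0 * (γ / P.sd w))) 0 := by
    have h1 : HasDerivAt (fun t : ℝ => t * γ / P.sd w) (γ / P.sd w) 0 :=
      (((hasDerivAt_id (0 : ℝ)).mul_const γ).div_const _).congr_deriv (by ring)
    have h2 : HasDerivAt (fun t : ℝ => stdNormalCDF (t * γ / P.sd w))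
        (gaussianPDFReal 0 1 0 * (γ / P.sd w)) 0 := by
      have h3 := hasDerivAt_stdNormalCDF ((0 : ℝ) * γ / P.sd w)
      have h4 := h3.comp (0 : ℝ) h1
      rw [zero_mul, zero_div] at h4
      exact h4
    have h5 : HasDerivAt (fun t : ℝ => t * P.U θ + (1 - t) * k) (P.U θ - k) 0 :=
      (((hasDerivAt_id (0 : ℝ)).mul_const (P.U θ)).add
        (((hasDerivAt_id (0 : ℝ)).const_sub 1).mul_const k)).congr_deriv (by ring)
    refine (h5.mul (h2.const_sub 1)).congr_deriv ?_
    simp only [zero_mul, zero_div, stdNormalCDF_zero]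
    ring
  have hle : (P.U θ - k) / 2 - k * (gaussianPDFReal 0 1 0 * (γ / P.sd w)) ≤ 0 := by
    refine le_of_tendsto hDd.tendsto_slope_zero_right ?_
    filter_upwards [Ioo_mem_nhdsGT (zero_lt_one' ℝ)] with t ht
    rw [zero_add, hD0, smul_eq_mul]
    exact mul_nonpos_of_nonneg_of_nonpos (inv_pos.2 ht.1).le (sub_nonpos.2 (hDle t ht))
  have e : 2 * gaussianPDFReal 0 1 0 * k / P.sd w * γ =
    2 * (k * (gaussianPDFReal 0 1 0 * (γ / P.sd w))) := by ring
  rw [e]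
  linarith

theorem expect_mono {d d' : EuclideanSpace ℝ (Fin n) → ℝ} (hd : d ∈ decisionRules n)
    (hd' : d' ∈ decisionRules n) (hle : ∀ y, d y ≤ d' y) (μ : EuclideanSpace ℝ (Fin n)) :
    P.expect μ d ≤ P.expect μ d' :=
  integral_mono (P.integrable_of_mem_decisionRules hd μ) (P.integrable_of_mem_decisionRules hd' μ)
    hle

/-- A monotone index rule with almost all values in `{0, 1}` jumps at one point, which is `0` if the
rule has mean `1/2` at `0`. -/
theorem eq_indicator_of_not_isRandomized (hw : w ≠ 0) {f : ℝ → ℝ} (hf : Monotone f)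
    (hf01 : ∀ t, f t ∈ Set.Icc (0 : ℝ) 1)
    (hnr : ¬ IsRandomized fun y : EuclideanSpace ℝ (Fin n) => f (inner ℝ w y))
    (hhalf : P.expect 0 (fun y => f (inner ℝ w y)) = 1 / 2) :
    (∀ t < 0, f t = 0) ∧ ∀ t > 0, f t = 1 := by
  rw [IsRandomized, not_not] at hnr
  have hσ := P.sd_pos hw
  have hrule : (fun y : EuclideanSpace ℝ (Fin n) => f (inner ℝ w y)) ∈ decisionRules n :=
    ⟨hf.measurable.comp (by fun_prop), fun y => hf01 _⟩
  have hjump : ∀ a b, a < b → f a = 0 ∨ f b = 1 := fun a b hab => by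
    by_contra! hcon
    obtain ⟨y, hy, hy'⟩ := exists_inner_mem_of_ae hw hnr isOpen_Ioo (Set.nonempty_Ioo.2 hab)
    have h1 := lt_of_le_of_ne (hf01 a).1 hcon.1.symm
    have h2 := lt_of_le_of_ne (hf01 b).2 hcon.2
    have h3 := hf hy.1.le
    have h4 := hf hy.2.le
    rcases hy' with h | h <;> rw [h] at h3 h4 <;> linarith
  -- if the jump were elsewhere, the mean at `0` could be compared with that of a step function
  have hstep : ∀ c : ℝ, (fun y : EuclideanSpace ℝ (Fin n) =>
      (if (inner ℝ w y : ℝ) ≤ c then (0 : ℝ) else 1)) ∈ decisionRules n ∧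
      P.expect 0 (fun y => if (inner ℝ w y : ℝ) ≤ c then (0 : ℝ) else 1) =
        stdNormalCDF (-c / P.sd w) := fun c => by
    refine ⟨⟨Measurable.ite (measurableSet_le (by fun_prop) measurable_const) measurable_const
      measurable_const, fun y => by dsimp only; split_ifs <;> simp⟩, ?_⟩
    rw [P.expect_indicator (f := fun t => if t ≤ c then 0 else 1) (c := c) hw
      (fun t ht => if_pos ht.le) (fun t ht => if_neg (not_le.2 ht)), inner_zero_right, zero_sub]
  constructor
  · intro t ht
    by_contra hne
    have hle := expect_mono (P := P) (hstep t).1 hrule (fun y => by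
      split_ifs with hy
      · exact (hf01 _).1
      · exact ((hjump t _ (not_le.1 hy)).resolve_left hne).ge) 0
    rw [(hstep t).2, hhalf, ← stdNormalCDF_zero] at hle
    exact hle.not_gt (strictMono_stdNormalCDF (div_pos (neg_pos.2 ht) hσ))
  · intro t ht
    by_contra hne
    have hle := expect_mono (P := P) hrule (hstep (t / 2)).1 (fun y => by
      split_ifs with hy
      · exact ((hjump _ t (by linarith)).resolve_right hne).le
      · exact (hf01 _).2) 0
    rw [(hstep _).2, hhalf, ← stdNormalCDF_zero] at hle
    exact hle.not_gt (strictMono_stdNormalCDF (div_neg_of_neg_of_pos (by linarith) hσ))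

theorem HasTangent.isRandomized (h : P.HasTangent w k s) (hlin : P.IsLinearSymmetric) (hk : 0 < k)
    (hw : w ≠ 0) (hsmax : ∀ s' ∈ P.superdiff w, |s'| ≤ |s|)
    (hlarge : |s| * P.sd w < 2 * gaussianPDFReal 0 1 0 * k)
    {d : EuclideanSpace ℝ (Fin n) → ℝ} (hd : P.IsMMR d) (hinc : IncreasingThrough w d) :
    IsRandomized d := by
  obtain ⟨f, hf, hf01, hdf⟩ := hinc
  obtain rfl : d = fun y => f (inner ℝ w y) := funext hdf
  by_contra hnr
  obtain ⟨h0, h1⟩ := eq_indicator_of_not_isRandomized hw hf hf01 hnr (h.expect_zero hlin hk hd)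
  have hmem := h.mem_superdiff hlin hk hd fun μ => by
    rw [P.expect_indicator hw h0 h1, sub_zero]
  have h2 := (le_abs_self _).trans (hsmax _ hmem)
  rw [div_le_iff₀ (P.sd_pos hw)] at h2
  linarith

theorem toReal_upperI_le {μ : EuclideanSpace ℝ (Fin n)} (hμ : μ ∈ P.M) {B : ℝ}
    (hB : ∀ θ ∈ P.Θ, P.m θ = μ → P.U θ ≤ B) : (P.upperI μ).toReal ≤ B := by
  obtain ⟨θ, hθ, rfl⟩ := hμ
  have h1 : P.upperI (P.m θ) ≤ B := iSup₂_le fun u hu => by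
    obtain ⟨θ', hθ', hm, rfl⟩ := hu
    exact EReal.coe_le_coe_iff.2 (hB θ' hθ' hm)
  have h2 := EReal.toReal_le_toReal h1 (ne_bot_of_le_ne_bot (EReal.coe_ne_bot _) (U_le_upperI hθ))
    (EReal.coe_ne_top B)
  rwa [EReal.toReal_coe] at h2

/-- If the upper bound `I` of the identified set is differentiable at `0`, then its gradient there
is `s w`, since `I` lies below the tangent line in the index. Optimality of a threshold rule with
normal vector `v` makes `μ ↦ I(μ) Φ(-vᵀμ / P.sd v)` maximal at `0`, and so the gradient is a
multiple of `v`. -/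
theorem HasTangent.smul_eq_smul (h : P.HasTangent w k s) (hlin : P.IsLinearSymmetric)
    (hpid : P.NontrivialPartialId) (hk : 0 < k)
    (hdiff : DifferentiableAt ℝ (fun μ => (P.upperI μ).toReal) 0)
    {d : EuclideanSpace ℝ (Fin n) → ℝ} (hd : P.IsMMR d) {v : EuclideanSpace ℝ (Fin n)}
    (hE : ∀ μ, P.expect μ d = stdNormalCDF (inner ℝ v μ / P.sd v)) :
    s • w = (2 * gaussianPDFReal 0 1 0 * k / P.sd v) • v := by
  have hM := hlin.M_mem_nhds hpid
  obtain ⟨A, hA⟩ := hdiff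
  have hI0 : (P.upperI 0).toReal = k := by rw [h.upperI_zero, EReal.toReal_coe]
  have h1 : IsLocalMax (fun μ => (P.upperI μ).toReal - s * inner ℝ w μ) 0 := by
    filter_upwards [hM] with μ hμ
    rw [hI0, inner_zero_right, mul_zero, sub_zero, sub_le_iff_le_add]
    exact toReal_upperI_le hμ fun θ hθ hm => hm ▸ h.U_le θ hθ
  have h2 : IsLocalMax (fun μ => (P.upperI μ).toReal *
      (1 - stdNormalCDF (inner ℝ v μ / P.sd v))) 0 := by
    filter_upwards [hM] with μ hμ
    rw [hI0, inner_zero_right, zero_div, stdNormalCDF_zero]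
    have hpos : 0 < 1 - stdNormalCDF (inner ℝ v μ / P.sd v) := sub_pos.2 (stdNormalCDF_lt_one _)
    refine (le_div_iff₀ hpos).1 (toReal_upperI_le hμ fun θ hθ hm => ?_)
    rw [le_div_iff₀ hpos, ← hE, ← hm]
    exact (h.U_mul_le hk hd hθ).trans_eq (by ring)
  have hv : ∀ u : EuclideanSpace ℝ (Fin n),
      HasFDerivAt (fun μ => (inner ℝ u μ : ℝ)) (innerSL ℝ u) 0 :=
    fun u => (innerSL ℝ u).hasFDerivAt
  have d1 := h1.hasFDerivAt_eq_zero (hA.sub ((hv w).const_mul s))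
  have hΦ : HasFDerivAt (fun μ => stdNormalCDF (inner ℝ v μ / P.sd v))
      (gaussianPDFReal 0 1 0 • ((P.sd v)⁻¹ • innerSL ℝ v)) 0 := by
    have h3 : HasFDerivAt (fun μ => (inner ℝ v μ : ℝ) / P.sd v) ((P.sd v)⁻¹ • innerSL ℝ v) 0 := by
      simp_rw [div_eq_mul_inv]
      exact (hv v).mul_const _
    have h4 := hasDerivAt_stdNormalCDF ((inner ℝ v (0 : EuclideanSpace ℝ (Fin n)) : ℝ) / P.sd v)
    have h5 := h4.comp_hasFDerivAt (0 : EuclideanSpace ℝ (Fin n)) h3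
    rw [inner_zero_right, zero_div] at h5
    exact h5
  have d2 := h2.hasFDerivAt_eq_zero (hA.mul (hΦ.const_sub 1))
  refine ext_inner_right ℝ fun x => ?_
  have e1 := congrArg (fun B => B x) d1
  have e2 := congrArg (fun B => B x) d2
  simp [hI0, stdNormalCDF_zero] at e1 e2
  rw [real_inner_smul_left, real_inner_smul_left]
  have e3 : 2 * gaussianPDFReal 0 1 0 * k / P.sd v * inner ℝ v x =
    2 * (k * (gaussianPDFReal 0 1 0 * ((P.sd v)⁻¹ * inner ℝ v x))) := by ring
  rw [e3]
  linarith

theorem HasTangent.not_isMMR_thresholdRule (h : P.HasTangent w k s) (hlin : P.IsLinearSymmetric)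
    (hpid : P.NontrivialPartialId) (hk : 0 < k)
    (hlarge : |s| * P.sd w < 2 * gaussianPDFReal 0 1 0 * k)
    (hdiff : DifferentiableAt ℝ (fun μ => (P.upperI μ).toReal) 0)
    (v : EuclideanSpace ℝ (Fin n)) (c : EReal) : ¬ P.IsMMR (thresholdRule v c) := by
  intro hd
  have hhalf := h.expect_zero hlin hk hd
  have hconst : ∀ b : ℝ, (∀ y, thresholdRule v c y = b) → b = 1 / 2 := fun b hb => by
    rw [funext hb] at hhalf
    simpa [expect] using hhalf
  have hv : v ≠ 0 := by
    rintro rfl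
    by_cases hc : c ≤ 0
    · exact absurd (hconst 1 fun y => by simp [thresholdRule, hc]) (by norm_num)
    · exact absurd (hconst 0 fun y => by simp [thresholdRule, hc]) (by norm_num)
  induction c with
  | bot => exact absurd (hconst 1 fun y => by simp [thresholdRule]) (by norm_num)
  | top => exact absurd (hconst 0 fun y => by simp [thresholdRule]) (by norm_num)
  | coe c =>
    have hσ := P.sd_pos hv
    have hE : ∀ μ, P.expect μ (thresholdRule v c) =
        stdNormalCDF ((inner ℝ v μ - c) / P.sd v) := fun μ => by
      have : thresholdRule v c = fun y => (fun t : ℝ => if c ≤ t then (1 : ℝ) else 0)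
          (inner ℝ v y) := by
        funext y; simp [thresholdRule]
      rw [this]
      exact P.expect_indicator hv (fun t ht => if_neg ht.not_ge)
        (fun t ht => if_pos (le_of_lt ht)) μ
    obtain rfl : c = 0 := by
      rw [hE, ← stdNormalCDF_zero] at hhalf
      have := strictMono_stdNormalCDF.injective hhalf
      rw [inner_zero_right, zero_sub, div_eq_zero_iff] at this
      rcases this with h | h <;> linarith
    have heq := congrArg P.sd (h.smul_eq_smul hlin hpid hk hdiff hd fun μ => by
      rw [hE, sub_zero])
    have hpos := stdNormalPDF_pos 0
    rw [sd_smul, sd_smul, abs_of_pos (by positivity : 0 < 2 * gaussianPDFReal 0 1 0 * k / P.sd v),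
      div_mul_cancel₀ _ hσ.ne'] at heq
    linarith

end TreatmentProblem

end

/-- `w` is the optimal index direction, and `s` the supergradient at `0` of `kbar w` of largest
absolute value. (If `w` is oriented so that the supergradients are nonnegative, as one may by
passing from `w` to `-w`, then `s` is the largest supergradient.) -/
theorem theorem3 {V : Type*} [AddCommGroup V] [Module ℝ V] {n : ℕ} (P : TreatmentProblem V n)
    (hpid : P.NontrivialPartialId) (hlin : P.IsLinearSymmetric)
    (w : EuclideanSpace ℝ (Fin n)) (hw : w ≠ 0)
    (hd : ∃ d : EuclideanSpace ℝ (Fin n) → ℝ, P.IsMMR d ∧ DependsThrough w d ∧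
      (∀ θ ∈ P.Θ, P.m θ = 0 → P.expect (P.m θ) d = 1 / 2) ∧
      P.worstRegret d = ⨆ θ ∈ {θ ∈ P.Θ | P.m θ = 0}, (P.regret d θ : EReal))
    (hgt : ∃ μ ∈ P.M, P.upperI 0 < P.upperI μ)
    (s : ℝ) (hs : s ∈ P.superdiff w) (hsmax : ∀ s' ∈ P.superdiff w, |s'| ≤ |s|)
    (hlarge : ((√(Real.pi / 2) * P.sd w * |s| : ℝ) : EReal) < P.upperI 0) :
    -- (i) infinitely many MMR rules, no two equal almost everywhere, and the piecewise linear rule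
    ((∃ f : ℕ → EuclideanSpace ℝ (Fin n) → ℝ, (∀ k, P.IsMMR (f k)) ∧
        Pairwise fun i j => ¬ f i =ᵐ[volume] f j) ∧
      (∃! ρ : ℝ, P.IsHalfWidth w |s| ρ) ∧
      ∀ ρ : ℝ, P.IsHalfWidth w |s| ρ →
        P.IsMMR fun y => piecewiseLinear ρ (Real.sign s * inner ℝ w y)) ∧
    -- (ii) monotone MMR rules in the index randomize
    (∀ d : EuclideanSpace ℝ (Fin n) → ℝ, P.IsMMR d → IncreasingThrough w d → IsRandomized d) ∧
    -- (iii) no linear threshold rule is MMR optimal if the upper bound is differentiable at zero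
    (DifferentiableAt ℝ (fun μ => (P.upperI μ).toReal) 0 →
      ∀ (v : EuclideanSpace ℝ (Fin n)) (c : EReal), ¬ P.IsMMR (thresholdRule v c)) := by
  obtain ⟨k, h, hs0⟩ := hlin.exists_hasTangent hd hgt hs
  have hσ := P.sd_pos hw
  have hs_pos := abs_pos.2 hs0
  have hpi : 0 < √(Real.pi / 2) := Real.sqrt_pos.2 (by positivity)
  rw [h.upperI_zero, EReal.coe_lt_coe_iff] at hlarge
  have hk : 0 < k := lt_of_le_of_lt (by positivity) hlarge
  have hsmall : |s| * P.sd w < 2 * gaussianPDFReal 0 1 0 * k := by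
    have h1 := mul_lt_mul_of_pos_left hlarge
      (mul_pos two_pos (stdNormalPDF_pos 0))
    have h2 := sqrt_pi_div_two_mul_stdNormalPDF_zero
    calc |s| * P.sd w = √(Real.pi / 2) * (2 * gaussianPDFReal 0 1 0) * (|s| * P.sd w) := by
          rw [h2, one_mul]
      _ = 2 * gaussianPDFReal 0 1 0 * (√(Real.pi / 2) * P.sd w * |s|) := by ring
      _ < _ := h1
  have hunique : ∃! ρ : ℝ, P.IsHalfWidth w |s| ρ := by
    have h1 := existsUnique_halfWidth (a := |s| / (2 * k)) (by positivity) hσ (by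
      rw [div_mul_eq_mul_div, div_lt_iff₀ (by positivity)]; linarith)
    have h2 : 1 / (2 * (|s| / (2 * k))) = k / |s| := by field_simp
    rw [h2] at h1
    simpa only [TreatmentProblem.IsHalfWidth, h.kbar_zero, EReal.toReal_coe] using h1
  have hlinear : ∀ ρ : ℝ, P.IsHalfWidth w |s| ρ →
      P.IsMMR fun y => piecewiseLinear ρ (Real.sign s * inner ℝ w y) :=
    fun ρ hρ => h.isMMR_piecewiseLinear hlin hk hw hs0 hρ
  refine ⟨⟨?_, hunique, hlinear⟩, fun d hd' => h.isRandomized hlin hk hw hsmax hsmall hd',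
    h.not_isMMR_thresholdRule hlin hpid hk hsmall⟩
  obtain ⟨ρ, hρ, -⟩ := hunique
  obtain ⟨τ, hτ⟩ := h.isMMR_normalCDF hlin hk hw hs0 hsmall
  exact h.exists_seq_isMMR hw hs0 (hlinear ρ hρ) hρ.1.1 hτ
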